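/- Let $\Bbbk$ be a field. A graded algebra means a unital associative $\Bbbk$-algebra $A=\bigoplus_{i\ge 0}A_i$ that is $\mathbb N$-graded and locally finite ($\dim_\Bbbk A_i<\infty$ for all $i$); put $A_{\ge n}=\bigoplus_{i\ge n}A_i$. A graded algebra $A$ is a GPerm algebra if $a(bc)=a(cb)$ for all $a\in A_{\ge 1}$ and $b,c\in A$. A PGPerm algebra is a graded algebra $A$ together with decompositions $A_i=A_{i,e}\oplus A_{i,o}$ for all $i\ge1$ such that the following hold, where $t(x)=0$ for $x\in A_0$ or $x\in A_{i,e}$, and $t(x)=1$ for $x\in A_{i,o}$; $A_{\ge n,e}=\bigoplus_{i\ge n}A_{i,e}$ and $A_{\ge n,o}=\bigoplus_{i\ge n}A_{i,o}$; and $\Xi=\mathrm{Id}_{A_{1,e}}-\mathrm{Id}_{A_{1,o}}$ is the corresponding linear map on $A_1$, written $x\mapsto x*\Xi$: - $A_{\ge1,e}$ and $A_{\ge1,o}$ are left ideals of $A$, and $A_{\ge2,e}$ and $A_{\ge2,o}$ are two-sided ideals of $A$. - For all homogeneous $x\in A_{\ge2}$ and all $y,z$, each lying in $A_0$, in some $A_{i,e}$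 or in some $A_{i,o}$, one has $x(yz)=a\,x(zy)$, where $a=-1$ if $y\in A_{i,o}$ and $z\in A_{j,o}$ with $i,j$ odd, and $a=1$ otherwise. - For $x\in A_1$ and $y,z\in A_0$: $\;(((xy)*\Xi)z)*\Xi=(((x*\Xi)z)*\Xi)y$. - For $x\in A_1$, $y\in A_0$ and $z\in A_{\ge1,e}\cup A_{\ge1,o}$: $\;((xy)*\Xi)z=((x*\Xi)z)y$. - For $x\in A_1$ and $y,z$ homogeneous, each in $A_{\ge1,e}\cup A_{\ge1,o}$: $\;(-1)^{\deg(z)(\deg(y)-1)t(y)}(xy)z=(-1)^{(\deg(z)-1)t(z)}((x*\Xi)z)y$. The even Veronese subring of $A$ is $A^{(2)}=\bigoplus_{i\ge0}A_{2i}$, graded with $A_{2i}$ in degree $i$. The Hilbert series of a graded space $M=\bigoplus_n M_n$ is $\sum_n(\dim_\Bbbk M_n)t^n$; it is rational if it is a quotient of two polynomials in $t$. The GK-dimension of an algebra $A$ is $\sup_V\limsup_{n\to\infty}\log_n\dim_\Bbbk V^n$, and that of a right $A$-module $M$ is $\sup_{F,V}\limsup_{n\to\infty}\log_n\dim_\Bbbk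 FV^n$, where $V$ runs over the finite-dimensional subspaces of $A$ containing $1$ and $F$ over the finite-dimensional subspaces of $M$ (the zero algebra and the zero module are given GK-dimension $0$). **Lemma 3.8.** Let $A$ be a PGPerm algebra that is finitely generated as a $\Bbbk$-algebra. 1. $A^{(2)}$ is a finitely generated algebra and, with the above grading, a GPerm algebra. 2. $A$ is a finitely generated right $A^{(2)}$-module, and $A$ is right noetherian. 3. The Hilbert series of $A$ is rational. 4. The GK-dimension of $A$ is a (finite, nonnegative) integer. 5. Every finitely generated $\mathbb Z$-graded right $A$-module $M$ is right noetherian, has finite integral GK-dimension, is locally finite and zero in sufficiently negative degrees, and has rational Hilbert series. -/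

import Mathlib

/-! ### Graded algebras

A graded algebra is a unital associative algebra `A` over a field `k` with an `ℕ`-grading
`A = ⨁ i, 𝒜 i` (Mathlib's `GradedAlgebra 𝒜`, so `1 ∈ 𝒜 0`) all of whose components are
finite dimensional. Only the last condition needs a name. -/

/-- All components of the family are finite dimensional. -/
def GradedLocallyFinite {k M ι : Type*} [Field k] [AddCommGroup M] [Module k M]
    (ℳ : ι → Submodule k M) : Prop :=
  ∀ i, FiniteDimensional k (ℳ i)

/-- Graded Perm algebras: `a (b c) = a (c b)` for all `a ∈ A_{≥ 1} = ⨁_{i ≥ 1} A_i` and all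
`b, c ∈ A`. -/
structure IsGPerm {k A : Type*} [Field k] [Ring A] [Algebra k A]
    (𝒜 : ℕ → Submodule k A) [GradedAlgebra 𝒜] : Prop where
  locallyFinite : GradedLocallyFinite 𝒜
  perm : ∀ a ∈ ⨆ i, ⨆ (_ : 1 ≤ i), 𝒜 i, ∀ b c : A, a * (b * c) = a * (c * b)

/-! ### Pseudo-graded-Perm algebras -/

/-- A decomposition of the components of a graded algebra into types: `comp t i` is `A_{i,e}` for
`t = false` and `A_{i,o}` for `t = true`, and `A_i = A_{i,e} ⊕ A_{i,o}`. In degree `0` there is no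
choice: elements of `A_0` have `t = 0`, which is recorded as `A_{0,e} = A_0` and `A_{0,o} = 0`. -/
structure TypeDecomposition {k A : Type*} [Field k] [Ring A] [Algebra k A]
    (𝒜 : ℕ → Submodule k A) where
  comp : Bool → ℕ → Submodule k A
  comp_even_zero : comp false 0 = 𝒜 0
  comp_odd_zero : comp true 0 = ⊥
  sup_eq : ∀ i, comp false i ⊔ comp true i = 𝒜 i
  disjoint : ∀ i, Disjoint (comp false i) (comp true i)

namespace TypeDecomposition

variable {k A : Type*} [Field k] [Ring A] [Algebra k A] {𝒜 : ℕ → Submodule k A}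

/-- `A_{≥ n, e}` or `A_{≥ n, o}`, the sum of all components of type `t` and degree at least `n`. -/
def geq (T : TypeDecomposition 𝒜) (n : ℕ) (t : Bool) : Submodule k A :=
  ⨆ i, ⨆ (_ : n ≤ i), T.comp t i

theorem comp_le (T : TypeDecomposition 𝒜) (t : Bool) (i : ℕ) : T.comp t i ≤ 𝒜 i := by
  rw [← T.sup_eq i]
  cases t
  · exact le_sup_left
  · exact le_sup_right

theorem isCompl_one (T : TypeDecomposition 𝒜) :
    IsCompl ((T.comp false 1).comap (𝒜 1).subtype) ((T.comp true 1).comap (𝒜 1).subtype) := by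
  constructor
  · rw [Submodule.disjoint_def]
    intro x hx hy
    exact Subtype.ext ((Submodule.disjoint_def.1 (T.disjoint 1)) x hx hy)
  · rw [codisjoint_iff, eq_top_iff]
    rintro ⟨x, hx⟩ -
    have hx' := hx
    rw [← T.sup_eq 1] at hx'
    obtain ⟨y, hy, z, hz, rfl⟩ := Submodule.mem_sup.1 hx'
    exact Submodule.mem_sup.2
      ⟨⟨y, T.comp_le _ _ hy⟩, hy, ⟨z, T.comp_le _ _ hz⟩, hz, rfl⟩

/-- The map `Ξ = Id_{A_{1,e}} - Id_{A_{1,o}}` on `A_1 = A_{1,e} ⊕ A_{1,o}`. It is extended by zero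
to the other components of `A`, but is only applied to elements of `A_1`. -/
noncomputable def xi [GradedAlgebra 𝒜] (T : TypeDecomposition 𝒜) : A →ₗ[k] A :=
  (𝒜 1).subtype ∘ₗ
    (Submodule.projection _ _ T.isCompl_one - Submodule.projection _ _ T.isCompl_one.symm) ∘ₗ
      DirectSum.component k ℕ (fun i => 𝒜 i) 1 ∘ₗ (DirectSum.decomposeLinearEquiv 𝒜).toLinearMap

theorem xi_even [GradedAlgebra 𝒜] (T : TypeDecomposition 𝒜) {x : A} (hx : x ∈ T.comp false 1) :
    T.xi x = x := by
  have h1 : x ∈ 𝒜 1 := T.comp_le _ _ hx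
  have h2 : (DirectSum.decompose 𝒜 x) 1 = ⟨x, h1⟩ :=
    Subtype.ext (DirectSum.decompose_of_mem_same 𝒜 h1)
  have h3 := Submodule.projection_apply_of_mem_left T.isCompl_one (x := ⟨x, h1⟩) hx
  have h4 := Submodule.projection_apply_of_mem_right T.isCompl_one.symm (x := ⟨x, h1⟩) hx
  have h5 : DirectSum.component k ℕ (fun i => 𝒜 i) 1 (DirectSum.decompose 𝒜 x) = ⟨x, h1⟩ := h2
  simp only [xi, LinearMap.comp_apply, LinearEquiv.coe_coe,
    DirectSum.decomposeLinearEquiv_apply, LinearMap.sub_apply]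
  rw [h5, h3, h4]
  simp

theorem xi_odd [GradedAlgebra 𝒜] (T : TypeDecomposition 𝒜) {x : A} (hx : x ∈ T.comp true 1) :
    T.xi x = -x := by
  have h1 : x ∈ 𝒜 1 := T.comp_le _ _ hx
  have h2 : (DirectSum.decompose 𝒜 x) 1 = ⟨x, h1⟩ :=
    Subtype.ext (DirectSum.decompose_of_mem_same 𝒜 h1)
  have h3 := Submodule.projection_apply_of_mem_left T.isCompl_one.symm (x := ⟨x, h1⟩) hx
  have h4 := Submodule.projection_apply_of_mem_right T.isCompl_one (x := ⟨x, h1⟩) hx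
  have h5 : DirectSum.component k ℕ (fun i => 𝒜 i) 1 (DirectSum.decompose 𝒜 x) = ⟨x, h1⟩ := h2
  simp only [xi, LinearMap.comp_apply, LinearEquiv.coe_coe,
    DirectSum.decomposeLinearEquiv_apply, LinearMap.sub_apply]
  rw [h5, h3, h4]
  simp

end TypeDecomposition

/-- Pseudo-graded-Perm algebras: a graded algebra `A`, with a decomposition `T` of its components
into types, satisfying the conditions below. A homogeneous element of `T.comp t i` has degree `i`
and type index `t(x) = t.toNat`. -/
structure IsPGPerm {k A : Type*} [Field k] [Ring A] [Algebra k A]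
    (𝒜 : ℕ → Submodule k A) [GradedAlgebra 𝒜] (T : TypeDecomposition 𝒜) : Prop where
  locallyFinite : GradedLocallyFinite 𝒜
  /-- `A_{≥ 1, o}` and `A_{≥ 1, e}` are left ideals. -/
  left_ideal : ∀ (t : Bool) (a : A), ∀ x ∈ T.geq 1 t, a * x ∈ T.geq 1 t
  /-- `A_{≥ 2, o}` and `A_{≥ 2, e}` are two-sided ideals. -/
  two_sided_ideal : ∀ (t : Bool) (a : A), ∀ x ∈ T.geq 2 t, a * x ∈ T.geq 2 t ∧ x * a ∈ T.geq 2 t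
  /-- `x (y z) = ± x (z y)` for `x` of degree at least `2`, where the sign is `-1` if `y` and `z`
  both have odd type and odd degree, and `1` otherwise. -/
  perm : ∀ i, 2 ≤ i → ∀ x ∈ 𝒜 i, ∀ (s t : Bool) (j l : ℕ), ∀ y ∈ T.comp s j, ∀ z ∈ T.comp t l,
    x * (y * z) =
      (if s = true ∧ t = true ∧ Odd j ∧ Odd l then (-1 : k) else 1) • (x * (z * y))
  /-- `(((x y) * Ξ) z) * Ξ = (((x * Ξ) z) * Ξ) y` for `x ∈ A_1` and `y, z ∈ A_0`. -/
  xi_zero_zero : ∀ x ∈ 𝒜 1, ∀ y ∈ 𝒜 0, ∀ z ∈ 𝒜 0,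
    T.xi (T.xi (x * y) * z) = T.xi (T.xi x * z) * y
  /-- `((x y) * Ξ) z = ((x * Ξ) z) y` for `x ∈ A_1`, `y ∈ A_0`, `z ∈ A_{≥ 1, e} ∪ A_{≥ 1, o}`. -/
  xi_zero_pos : ∀ x ∈ 𝒜 1, ∀ y ∈ 𝒜 0, ∀ (t : Bool), ∀ z ∈ T.geq 1 t,
    T.xi (x * y) * z = T.xi x * z * y
  /-- `(-1)^{deg z (deg y - 1) t(y)} (x y) z = (-1)^{(deg z - 1) t(z)} ((x * Ξ) z) y` for `x ∈ A_1`
  and homogeneous `y, z` of positive degree, each of even or odd type. -/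
  xi_pos_pos : ∀ x ∈ 𝒜 1, ∀ (s t : Bool) (j l : ℕ), 1 ≤ j → 1 ≤ l →
    ∀ y ∈ T.comp s j, ∀ z ∈ T.comp t l,
      (-1 : k) ^ (l * (j - 1) * s.toNat) • (x * y * z) =
        (-1 : k) ^ ((l - 1) * t.toNat) • (T.xi x * z * y)

/-! ### Veronese subalgebras -/

section Veronese

variable {k A : Type*} [Field k] [Ring A] [Algebra k A] (𝒜 : ℕ → Submodule k A) [GradedAlgebra 𝒜]

/-- The Veronese subalgebra `A^{(w)} = ⨁ i, A_{w i}`. -/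
def veronese (w : ℕ) : Subalgebra k A :=
  Submodule.toSubalgebra (⨆ i, 𝒜 (w * i))
    (Submodule.mem_iSup_of_mem 0 (by simpa using SetLike.GradedOne.one_mem))
    (by
      intro x y hx hy
      induction hx using Submodule.iSup_induction' with
      | zero => simp
      | add a b _ _ ha hb => rw [add_mul]; exact add_mem ha hb
      | mem i a ha =>
        induction hy using Submodule.iSup_induction' with
        | zero => simp
        | add c d _ _ hc hd => rw [mul_add]; exact add_mem hc hd
        | mem j c hc =>
          refine Submodule.mem_iSup_of_mem (i + j) ?_
          rw [mul_add]
          exact SetLike.mul_mem_graded ha hc)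

/-- The grading of the Veronese subalgebra: its component of degree `i` is `A_{w i}`. -/
def veroneseGrading (w : ℕ) (i : ℕ) : Submodule k (veronese 𝒜 w) :=
  (𝒜 (w * i)).comap (veronese 𝒜 w).val.toLinearMap

theorem veroneseGrading_isInternal (w : ℕ) [NeZero w] :
    DirectSum.IsInternal (veroneseGrading 𝒜 w) := by
  have hmap : ∀ i, (veroneseGrading 𝒜 w i).map (veronese 𝒜 w).val.toLinearMap = 𝒜 (w * i) := by
    intro i
    ext x
    constructor
    · rintro ⟨y, hy, rfl⟩
      exact hy
    · intro hx
      exact ⟨⟨x, Submodule.mem_iSup_of_mem i hx⟩, hx, rfl⟩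
  have hinj : Function.Injective (veronese 𝒜 w).val.toLinearMap := Subtype.val_injective
  rw [DirectSum.isInternal_submodule_iff_iSupIndep_and_iSup_eq_top]
  constructor
  · have hind : iSupIndep fun i => 𝒜 (w * i) :=
      (DirectSum.Decomposition.isInternal 𝒜).submodule_iSupIndep.comp
        (mul_right_injective₀ (NeZero.ne w))
    intro i
    rw [Submodule.disjoint_def]
    intro x hx hy
    apply hinj
    rw [map_zero]
    refine (Submodule.disjoint_def.1 (hind i)) _ hx ?_
    have := Submodule.mem_map_of_mem (f := (veronese 𝒜 w).val.toLinearMap) hy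
    simpa only [Submodule.map_iSup, hmap] using this
  · apply Submodule.map_injective_of_injective hinj
    simp only [Submodule.map_iSup, hmap]
    ext x
    constructor
    · intro hx
      exact ⟨⟨x, hx⟩, trivial, rfl⟩
    · rintro ⟨y, -, rfl⟩
      exact y.2

noncomputable instance veroneseGradedAlgebra (w : ℕ) [NeZero w] :
    GradedAlgebra (veroneseGrading 𝒜 w) where
  one_mem := by
    have h : (1 : A) ∈ 𝒜 0 := SetLike.GradedOne.one_mem
    simpa [veroneseGrading] using h
  mul_mem i j a b ha hb := by
    have h : (a : A) * b ∈ 𝒜 (w * i + w * j) := SetLike.mul_mem_graded ha hb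
    rw [← mul_add] at h
    exact h
  toDecomposition := (veroneseGrading_isInternal 𝒜 w).chooseDecomposition

end Veronese

/-! ### Graded right modules

A right `A`-module is a module over the opposite algebra `Aᵐᵒᵖ`. -/

/-- `ℳ` makes `M` a (`ℤ`-)graded right `A`-module: `M = ⨁ j, ℳ j` and `ℳ j · 𝒜 i ⊆ ℳ (j + i)`. -/
structure IsGradedRightModule {k A M : Type*} [Field k] [Ring A] [Algebra k A] [AddCommGroup M]
    [Module k M] [Module Aᵐᵒᵖ M] (𝒜 : ℕ → Submodule k A) (ℳ : ℤ → Submodule k M) : Prop where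
  isInternal : DirectSum.IsInternal ℳ
  smul_mem : ∀ (i : ℕ) (j : ℤ), ∀ a ∈ 𝒜 i, ∀ m ∈ ℳ j, MulOpposite.op a • m ∈ ℳ (j + i)

/-! ### Hilbert series -/

/-- A formal Laurent series is rational if it is a quotient `p / q` of polynomials, `q ≠ 0`. -/
def IsRationalSeries (H : LaurentSeries ℚ) : Prop :=
  ∃ p q : Polynomial ℚ, q ≠ 0 ∧
    ((q : PowerSeries ℚ) : LaurentSeries ℚ) * H = ((p : PowerSeries ℚ) : LaurentSeries ℚ)

/-- The Hilbert series `∑ (dim A_n) t^n` of an `ℕ`-graded space (with finite dimensional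
components). -/
noncomputable def hilbertSeries {k A : Type*} [Field k] [AddCommGroup A] [Module k A]
    (𝒜 : ℕ → Submodule k A) : PowerSeries ℚ :=
  PowerSeries.mk fun n => (Module.finrank k (𝒜 n) : ℚ)

/-- A `ℤ`-graded space has a rational Hilbert series: its components are finite dimensional, they
vanish in sufficiently negative degrees, and the Laurent series `∑ (dim M_n) t^n` is rational. -/
def HasRationalHilbertSeries {k M : Type*} [Field k] [AddCommGroup M] [Module k M]
    (ℳ : ℤ → Submodule k M) : Prop :=
  GradedLocallyFinite ℳ ∧
    ∃ H : LaurentSeries ℚ, (∀ n : ℤ, H.coeff n = (Module.finrank k (ℳ n) : ℚ)) ∧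
      IsRationalSeries H

/-! ### Gelfand-Kirillov dimension -/

/-- The growth exponent `limsup log_n (f n)` of a sequence (with `log 0` read as `0`, so that the
zero sequence has exponent `0`). -/
noncomputable def growthExponent (f : ℕ → ℕ) : EReal :=
  Filter.limsup (fun n : ℕ => ((Real.log (f n) / Real.log n : ℝ) : EReal)) Filter.atTop

/-- The Gelfand-Kirillov dimension of an algebra: the supremum of `limsup log_n (dim V^n)` over all
finite dimensional subspaces `V` containing `1`. -/
noncomputable def gkDim (k A : Type*) [Field k] [Ring A] [Algebra k A] : EReal :=
  ⨆ (V : Submodule k A) (_ : V.FG) (_ : (1 : A) ∈ V),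
    growthExponent fun n => Module.finrank k ↥(V ^ n)

/-- The subspace `F W` of a right `A`-module spanned by the elements `m a`, `m ∈ F`, `a ∈ W`. -/
def rightMulSpan {k A M : Type*} [Field k] [Ring A] [Algebra k A] [AddCommGroup M]
    [Module k M] [Module Aᵐᵒᵖ M] (F : Submodule k M) (W : Submodule k A) : Submodule k M :=
  Submodule.span k {x | ∃ m ∈ F, ∃ a ∈ W, x = MulOpposite.op a • m}

/-- The Gelfand-Kirillov dimension of a right `A`-module: the supremum of
`limsup log_n (dim F V^n)` over all finite dimensional subspaces `F` of `M` and `V` of `A` with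
`1 ∈ V`. -/
noncomputable def gkDimRight (k A M : Type*) [Field k] [Ring A] [Algebra k A] [AddCommGroup M]
    [Module k M] [Module Aᵐᵒᵖ M] : EReal :=
  ⨆ (F : Submodule k M) (_ : F.FG) (V : Submodule k A) (_ : V.FG) (_ : (1 : A) ∈ V),
    growthExponent fun n => Module.finrank k ↥(rightMulSpan F (V ^ n))

/-! The sign in the axiom `perm` is trivial as soon as one of the two swapped factors has even
degree, so x(ca) = x(ac) whenever x has degree at least 2 and c has even degree
(`IsPGPerm.mul_mul_comm_of_even`). Let A be generated in degrees at most d, and let M be a finitely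
generated graded right module. In large degrees every element of M is a sum of terms mvw with v and
w of positive degree, so elements of A of even degree act centrally there (`exists_hasCentralTail`).
Moreover finitely many components generate the tail of M under A_2, A_4, ..., A_{2d} alone: an odd
generator either moves past an even one or combines with another odd one into an element of even
degree at most 2d (`HasCentralTail.gradedTail_le`).

The tail is thus a finitely generated graded module over a finitely generated commutative algebra,
and its complement is finite dimensional. Hilbert's basis theorem (`exists_fg_generating`) makes M
noetherian, and the Hilbert-Serre theorem (`exists_prod_mul_quotientSeries`) makes its Hilbert
series rational with denominator a product of factors 1 - X^e. The partial sums of such a series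
grow like an integral power of n (`exists_growth_degree`). The spaces FV^n lie in degrees bounded
linearly in n, and for suitable F and V they contain all degrees up to n, so the GK-dimension is
that exponent.

Applied to A as a module over itself, this yields the claims on A. The generation statement for the
tail also gives both finiteness claims on the even Veronese subring. -/

open MulOpposite

set_option linter.unusedSectionVars false

/-! ### Projections to graded components -/

section GradedProj

variable {k M ι : Type*} [Field k] [AddCommGroup M] [Module k M] [DecidableEq ι]
  (ℳ : ι → Submodule k M) [DirectSum.Decomposition ℳ]

/-- The projection of a graded space to its component of degree `i`. -/
noncomputable def gradedProj (i : ι) : M →ₗ[k] M :=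
  (ℳ i).subtype ∘ₗ DirectSum.component k ι (fun i => ℳ i) i ∘ₗ
    (DirectSum.decomposeLinearEquiv ℳ).toLinearMap

theorem gradedProj_apply (i : ι) (x : M) :
    gradedProj ℳ i x = (DirectSum.decompose ℳ x i : M) := rfl

theorem gradedProj_mem (i : ι) (x : M) : gradedProj ℳ i x ∈ ℳ i :=
  (DirectSum.decompose ℳ x i).2

theorem gradedProj_of_mem {i : ι} {x : M} (hx : x ∈ ℳ i) : gradedProj ℳ i x = x :=
  DirectSum.decompose_of_mem_same ℳ hx

theorem gradedProj_of_mem_ne {i j : ι} {x : M} (hx : x ∈ ℳ i) (h : i ≠ j) :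
    gradedProj ℳ j x = 0 :=
  DirectSum.decompose_of_mem_ne ℳ hx h

theorem mem_of_gradedProj_mem {L : Submodule k M} {x : M}
    (h : ∀ i, gradedProj ℳ i x ∈ L) : x ∈ L := by
  classical
  rw [← DirectSum.sum_support_decompose ℳ x]
  exact sum_mem fun i _ => h i

theorem iSup_eq_top_of_decomposition : ⨆ i, ℳ i = ⊤ :=
  (DirectSum.Decomposition.isInternal ℳ).submodule_iSup_eq_top

theorem gradedProj_eq_zero_of_mem_biSup {s : Set ι} {x : M} (hx : x ∈ ⨆ i ∈ s, ℳ i) {j : ι}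
    (hj : j ∉ s) : gradedProj ℳ j x = 0 := by
  have : ⨆ i ∈ s, ℳ i ≤ LinearMap.ker (gradedProj ℳ j) :=
    iSup₂_le fun i hi y hy => gradedProj_of_mem_ne ℳ hy (by rintro rfl; exact hj hi)
  exact this hx

theorem mem_biSup_of_gradedProj {s : Set ι} {x : M} (hx : ∀ j ∉ s, gradedProj ℳ j x = 0) :
    x ∈ ⨆ i ∈ s, ℳ i := by
  refine mem_of_gradedProj_mem ℳ fun i => ?_
  by_cases hi : i ∈ s
  · exact Submodule.mem_iSup_of_mem i (Submodule.mem_iSup_of_mem hi (gradedProj_mem ℳ i x))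
  · rw [hx i hi]; exact zero_mem _

theorem exists_finset_of_fg {F : Submodule k M} (hF : F.FG) :
    ∃ s : Finset ι, ∀ x ∈ F, ∀ i ∉ s, gradedProj ℳ i x = 0 := by
  classical
  obtain ⟨S, rfl⟩ := hF
  refine ⟨S.biUnion fun x => (DirectSum.decompose ℳ x).support, fun x hx i hi => ?_⟩
  have : Submodule.span k (S : Set M) ≤ LinearMap.ker (gradedProj ℳ i) := by
    rw [Submodule.span_le]
    intro y hy
    have : i ∉ (DirectSum.decompose ℳ y).support := fun h =>
      hi (Finset.mem_biUnion.2 ⟨y, hy, h⟩)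
    rw [DFinsupp.notMem_support_iff] at this
    simp [gradedProj_apply, this]
  exact this hx

end GradedProj

/-! ### Hilbert's basis theorem for commuting operators -/

section StableSubspaces

variable {k M ι : Type*} [Field k] [AddCommGroup M] [Module k M] (φ : ι → M →ₗ[k] M)

/-- The subspace `L` is mapped to itself by all the `φ i`. -/
def IsStable (L : Submodule k M) : Prop := ∀ i, ∀ x ∈ L, φ i x ∈ L

/-- The algebra `S` generated by the operators is commutative and finitely generated, hence
noetherian, and `U` generates V over it. Stable subspaces are exactly the `S`-submodules, so each is
finitely generated. The conclusion avoids `S`, so that it can be used without naming a ring. -/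
theorem exists_fg_generating_of_commute {V : Type*} [AddCommGroup V] [Module k V] [Finite ι]
    (ψ : ι → Module.End k V) (hcomm : ∀ i j, ψ i * ψ j = ψ j * ψ i) {U : Submodule k V}
    (hU : U.FG) (hgen : ∀ L, U ≤ L → IsStable ψ L → L = ⊤) (L : Submodule k V)
    (hL : IsStable ψ L) :
    ∃ F ≤ L, F.FG ∧ ∀ L', F ≤ L' → IsStable ψ L' → L ≤ L' := by
  let S := Algebra.adjoin k (Set.range ψ)
  have hS : IsNoetherianRing S := by
    have : IsMulCommutative S := Algebra.isMulCommutative_adjoin k (s := Set.range ψ) (by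
      rintro _ ⟨i, rfl⟩ _ ⟨j, rfl⟩; exact hcomm i j)
    let _ : CommRing S := { (inferInstance : Ring S) with mul_comm := this.is_comm.comm }
    have hf : Algebra.FiniteType k S :=
      S.fg_iff_finiteType.1 (Subalgebra.fg_def.2 ⟨_, Set.finite_range ψ, rfl⟩)
    exact Algebra.FiniteType.isNoetherianRing k S
  have stable (P : Submodule S V) : IsStable ψ (P.restrictScalars k) := fun i x hx =>
    P.smul_mem (⟨ψ i, Algebra.subset_adjoin ⟨i, rfl⟩⟩ : S) hx
  have hfin : Module.Finite S V := by
    obtain ⟨s, rfl⟩ := hU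
    refine ⟨⟨s, ?_⟩⟩
    have := hgen ((Submodule.span S (s : Set V)).restrictScalars k)
      (Submodule.span_le.2 Submodule.subset_span) (stable _)
    exact (Submodule.restrictScalars_eq_top_iff k S V).1 this
  have hV : IsNoetherian S V := isNoetherian_of_isNoetherianRing_of_finite S V
  have upgrade (P : Submodule k V) (hP : IsStable ψ P) (a : S) (x : V) (hx : x ∈ P) :
      a • x ∈ P := by
    obtain ⟨a, ha⟩ := a
    change a x ∈ P
    induction ha using Algebra.adjoin_induction generalizing x with
    | mem a ha => obtain ⟨i, rfl⟩ := ha; exact hP i x hx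
    | algebraMap r => exact P.smul_mem r hx
    | add a b _ _ ha hb => exact P.add_mem (ha x hx) (hb x hx)
    | mul a b _ _ ha hb => exact ha _ (hb x hx)
  let LS (P : Submodule k V) (hP : IsStable ψ P) : Submodule S V :=
    { P with smul_mem' := fun a x hx => upgrade P hP a x hx }
  obtain ⟨s, hs⟩ := IsNoetherian.noetherian (LS L hL)
  refine ⟨Submodule.span k s, ?_, ⟨s, rfl⟩, fun L' hFL' hL' => ?_⟩
  · rw [Submodule.span_le]
    intro x hx
    have : x ∈ LS L hL := hs ▸ Submodule.subset_span hx
    exact this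
  · have : LS L hL ≤ LS L' hL' := by
      rw [← hs, Submodule.span_le]
      exact fun x hx => hFL' (Submodule.subset_span hx)
    exact this

/-- Even elements of the algebra commute only on the tail of a module, so commutation is assumed on
`T` alone and the operators are restricted to it. -/
theorem exists_fg_generating [Finite ι] {T U : Submodule k M} (hT : IsStable φ T)
    (hcomm : ∀ i j, ∀ x ∈ T, φ i (φ j x) = φ j (φ i x)) (hU : U.FG) (hUT : U ≤ T)
    (hgen : ∀ L, U ≤ L → IsStable φ L → T ≤ L) {L : Submodule k M} (hLT : L ≤ T)
    (hL : IsStable φ L) :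
    ∃ F ≤ L, F.FG ∧ ∀ L', F ≤ L' → IsStable φ L' → L ≤ L' := by
  let ψ : ι → Module.End k T := fun i => (φ i).restrict (hT i)
  have down (P : Submodule k M) (hP : IsStable φ P) : IsStable ψ (P.comap T.subtype) :=
    fun i x hx => hP i x hx
  have up (P : Submodule k T) (hP : IsStable ψ P) : IsStable φ (P.map T.subtype) := by
    rintro i _ ⟨x, hx, rfl⟩
    exact ⟨ψ i x, hP i x hx, rfl⟩
  obtain ⟨F, hFL, hF, h⟩ := exists_fg_generating_of_commute ψ
    (fun i j => LinearMap.ext fun x => Subtype.ext (hcomm i j x x.2))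
    (U := U.comap T.subtype)
    (Submodule.fg_of_fg_map_injective T.subtype T.injective_subtype (by
      rwa [Submodule.map_comap_subtype, inf_eq_right.2 hUT]))
    (fun P hUP hP => by
      rw [eq_top_iff]
      rintro x -
      obtain ⟨y, hy, hyx⟩ := hgen (P.map T.subtype) (fun u hu => ⟨⟨u, hUT hu⟩, hUP hu, rfl⟩)
        (up P hP) x.2
      rwa [← Subtype.ext hyx]) (L.comap T.subtype) (down L hL)
  refine ⟨F.map T.subtype, ?_, hF.map _, fun L' hL' hs x hx => ?_⟩
  · rintro _ ⟨x, hx, rfl⟩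
    exact hFL hx
  · exact h (L'.comap T.subtype) (fun y hy => hL' ⟨y, hy, rfl⟩) (down L' hs)
      (x := ⟨x, hLT hx⟩) hx

end StableSubspaces

/-! ### The Hilbert-Serre theorem -/

section HilbertSerre

theorem finrank_map_add_finrank_inf_ker {k V W : Type*} [Field k] [AddCommGroup V] [Module k V]
    [AddCommGroup W] [Module k W] (f : V →ₗ[k] W) (P : Submodule k V) [FiniteDimensional k P] :
    Module.finrank k (P.map f) + Module.finrank k ↥(P ⊓ LinearMap.ker f) =
      Module.finrank k P := by
  rw [← LinearMap.finrank_range_add_finrank_ker (f.domRestrict P), LinearMap.range_domRestrict,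
    LinearMap.ker_domRestrict, ← Submodule.map_comap_subtype,
    (Submodule.equivMapOfInjective P.subtype P.injective_subtype _).finrank_eq]

variable {k M ι : Type*} [Field k] [AddCommGroup M] [Module k M] [DecidableEq ι]
  (ℳ : ℤ → Submodule k M) [DirectSum.Decomposition ℳ] (φ : ι → M →ₗ[k] M) (e : ι → ℕ)

theorem gradedProj_add_of_map_le {f : M →ₗ[k] M} {c : ℤ}
    (hf : ∀ n, ∀ x ∈ ℳ n, f x ∈ ℳ (n + c)) (n : ℤ) (x : M) :
    gradedProj ℳ (n + c) (f x) = f (gradedProj ℳ n x) := by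
  have : gradedProj ℳ (n + c) ∘ₗ f = f ∘ₗ gradedProj ℳ n := by
    refine DirectSum.decompose_lhom_ext ℳ fun i => LinearMap.ext fun ⟨y, hy⟩ => ?_
    simp only [LinearMap.comp_apply, Submodule.subtype_apply]
    by_cases h : i = n
    · subst h
      rw [gradedProj_of_mem ℳ hy, gradedProj_of_mem ℳ (hf _ _ hy)]
    · rw [gradedProj_of_mem_ne ℳ hy h, gradedProj_of_mem_ne ℳ (hf _ _ hy) (by omega), map_zero]
  exact LinearMap.congr_fun this x

/-- The generating series of the dimensions of the components of `L / N`, starting in degree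
`n₀`. -/
noncomputable def quotientSeries (n₀ : ℤ) (L N : Submodule k M) : PowerSeries ℚ :=
  PowerSeries.mk fun n : ℕ => (Module.finrank k ↥(L ⊓ ℳ (n₀ + n)) : ℚ) -
    Module.finrank k ↥(N ⊓ ℳ (n₀ + n))

/-- Rank-nullity, used twice for one space: the image of f(L_n) in M/N is also the image of (N +
f(L))_{n+c}. Equality of these images needs L and N to be graded. -/
theorem finrank_add_finrank_of_stable (hfin : GradedLocallyFinite ℳ) {f : M →ₗ[k] M} {c : ℤ}
    (hf : ∀ n, ∀ x ∈ ℳ n, f x ∈ ℳ (n + c)) {L N : Submodule k M}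
    (hL : ∀ n, ∀ x ∈ L, gradedProj ℳ n x ∈ L) (hN : ∀ n, ∀ x ∈ N, gradedProj ℳ n x ∈ N) (n : ℤ) :
    Module.finrank k ↥(L ⊓ ℳ n) + Module.finrank k ↥(N ⊓ ℳ (n + c)) =
      Module.finrank k ↥(L ⊓ N.comap f ⊓ ℳ n) + Module.finrank k ↥((N ⊔ L.map f) ⊓ ℳ (n + c)) := by
  have h₁ : FiniteDimensional k (ℳ n) := hfin n
  have h₂ : FiniteDimensional k (ℳ (n + c)) := hfin (n + c)
  have h₃ : FiniteDimensional k ↥(L ⊓ ℳ n) := Submodule.finiteDimensional_inf_right _ _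
  have h₄ : FiniteDimensional k ↥((N ⊔ L.map f) ⊓ ℳ (n + c)) :=
    Submodule.finiteDimensional_inf_right _ _
  rw [← finrank_map_add_finrank_inf_ker (N.mkQ ∘ₗ f) (L ⊓ ℳ n),
    ← finrank_map_add_finrank_inf_ker N.mkQ ((N ⊔ L.map f) ⊓ ℳ (n + c))]
  have e₁ : (L ⊓ ℳ n).map (N.mkQ ∘ₗ f) = ((N ⊔ L.map f) ⊓ ℳ (n + c)).map N.mkQ := by
    apply le_antisymm
    · rintro _ ⟨x, hx, rfl⟩
      exact ⟨f x, ⟨Submodule.mem_sup_right ⟨x, hx.1, rfl⟩, hf _ _ hx.2⟩, rfl⟩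
    · rintro _ ⟨y, ⟨hy, hyn⟩, rfl⟩
      obtain ⟨z, hz, _, ⟨x, hx, rfl⟩, rfl⟩ := Submodule.mem_sup.1 hy
      refine ⟨gradedProj ℳ n x, ⟨hL _ _ hx, gradedProj_mem ℳ _ _⟩, ?_⟩
      rw [← gradedProj_of_mem ℳ hyn, map_add, gradedProj_add_of_map_le ℳ hf, map_add,
        (Submodule.Quotient.mk_eq_zero N).2 (hN _ _ hz) |> (show N.mkQ _ = 0 from ·), zero_add]
      rfl
  have e₂ : L ⊓ ℳ n ⊓ LinearMap.ker (N.mkQ ∘ₗ f) = L ⊓ N.comap f ⊓ ℳ n := by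
    rw [LinearMap.ker_comp, Submodule.ker_mkQ, inf_right_comm]
  have e₃ : (N ⊔ L.map f) ⊓ ℳ (n + c) ⊓ LinearMap.ker N.mkQ = N ⊓ ℳ (n + c) := by
    rw [Submodule.ker_mkQ, inf_right_comm, inf_eq_right.2 (le_sup_left : N ≤ N ⊔ L.map f)]
  rw [e₁, e₂, e₃]
  omega

/-- The Hilbert-Serre theorem for the subquotients `L / N` of a graded space `T` with finitely many
commuting homogeneous endomorphisms `φ i`. -/
theorem exists_prod_mul_quotientSeries (hfin : GradedLocallyFinite ℳ)
    (hφ : ∀ i n, ∀ x ∈ ℳ n, φ i x ∈ ℳ (n + e i)) {T : Submodule k M} {n₀ : ℤ}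
    (hT₀ : ∀ n < n₀, T ⊓ ℳ n = ⊥)
    (hcomm : ∀ i j, ∀ x ∈ T, φ i (φ j x) = φ j (φ i x))
    (hT : ∀ L ≤ T, IsStable φ L → ∃ F ≤ L, F.FG ∧ ∀ L', F ≤ L' → IsStable φ L' → L ≤ L')
    (S : Finset ι) : ∀ L N : Submodule k M, L ≤ T → N ≤ L → IsStable φ L → IsStable φ N →
      (∀ n, ∀ x ∈ L, gradedProj ℳ n x ∈ L) → (∀ n, ∀ x ∈ N, gradedProj ℳ n x ∈ N) →
      (∀ i ∉ S, ∀ x ∈ L, φ i x ∈ N) →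
      ∃ p : Polynomial ℚ, (∏ i ∈ S, (1 - PowerSeries.X ^ e i)) * quotientSeries ℳ n₀ L N = p := by
  induction S using Finset.induction_on with
  | empty =>
    intro L N hLT hNL hLs hNs hLh hNh hS
    -- Every operator kills L/N here, so `F ⊔ N` is stable and equals L. Hence L/N is finite
    -- dimensional and lives in finitely many degrees.
    obtain ⟨F, hFL, hF, hgen⟩ := hT L hLT hLs
    obtain ⟨s, hs⟩ := exists_finset_of_fg ℳ hF
    have hL : L ≤ F ⊔ N := hgen _ le_sup_left fun i x hx =>
      Submodule.mem_sup_right (hS i (Finset.notMem_empty i) x (sup_le hFL hNL hx))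
    have hzero : ∀ n ∉ s, L ⊓ ℳ n = N ⊓ ℳ n := by
      intro n hn
      refine le_antisymm (fun x hx => ⟨?_, hx.2⟩) (inf_le_inf_right _ hNL)
      obtain ⟨u, hu, v, hv, rfl⟩ := Submodule.mem_sup.1 (hL hx.1)
      rw [← gradedProj_of_mem ℳ hx.2, map_add, hs u hu n hn, zero_add]
      exact hNh n v hv
    obtain ⟨b, hb⟩ := s.bddAbove
    refine ⟨(quotientSeries ℳ n₀ L N).trunc ((b - n₀).toNat + 1), ?_⟩
    ext n
    rw [Finset.prod_empty, one_mul, Polynomial.coeff_coe, PowerSeries.coeff_trunc]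
    split_ifs with h
    · rfl
    · have : n₀ + n ∉ s := fun h' => by
        have := hb h'
        omega
      rw [quotientSeries, PowerSeries.coeff_mk, hzero _ this, sub_self]
  | insert c S hc ih =>
    intro L N hLT hNL hLs hNs hLh hNh hS
    -- Kernel and cokernel of `φ c` on L/N are again subquotients by stable graded subspaces. Both
    -- are killed by `φ c`, so the induction hypothesis for `S` applies to them.
    have hK : N ≤ L ⊓ N.comap (φ c) := le_inf hNL fun x hx => hNs c x hx
    have hJ : N ⊔ L.map (φ c) ≤ L :=
      sup_le hNL (by rintro _ ⟨x, hx, rfl⟩; exact hLs c x hx)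
    have hKh : ∀ n, ∀ x ∈ L ⊓ N.comap (φ c), gradedProj ℳ n x ∈ L ⊓ N.comap (φ c) := by
      refine fun n x hx => ⟨hLh n x hx.1, ?_⟩
      change φ c (gradedProj ℳ n x) ∈ N
      rw [← gradedProj_add_of_map_le ℳ (hφ c)]
      exact hNh _ _ hx.2
    have hJh : ∀ n, ∀ x ∈ N ⊔ L.map (φ c), gradedProj ℳ n x ∈ N ⊔ L.map (φ c) := by
      intro n x hx
      obtain ⟨z, hz, _, ⟨y, hy, rfl⟩, rfl⟩ := Submodule.mem_sup.1 hx
      rw [map_add, show n = (n - e c) + e c by ring, gradedProj_add_of_map_le ℳ (hφ c)]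
      exact add_mem (Submodule.mem_sup_left (hNh _ _ hz))
        (Submodule.mem_sup_right ⟨_, hLh _ _ hy, rfl⟩)
    obtain ⟨p, hp⟩ := ih L (N ⊔ L.map (φ c)) hLT hJ hLs
      (by
        intro i x hx
        obtain ⟨z, hz, _, ⟨y, hy, rfl⟩, rfl⟩ := Submodule.mem_sup.1 hx
        rw [map_add, hcomm i c y (hLT hy)]
        exact add_mem (Submodule.mem_sup_left (hNs i z hz))
          (Submodule.mem_sup_right ⟨_, hLs i y hy, rfl⟩)) hLh hJh
      (by
        intro i hi x hx
        by_cases hic : i = c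
        · subst hic; exact Submodule.mem_sup_right ⟨x, hx, rfl⟩
        · exact Submodule.mem_sup_left (hS i (by simp [hic, hi]) x hx))
    obtain ⟨q, hq⟩ := ih (L ⊓ N.comap (φ c)) N (inf_le_left.trans hLT) hK
      (by
        refine fun i x hx => ⟨hLs i x hx.1, ?_⟩
        change φ c (φ i x) ∈ N
        rw [hcomm c i x (hLT hx.1)]
        exact hNs i _ hx.2) hNs hKh hNh
      (by
        intro i hi x hx
        by_cases hic : i = c
        · subst hic; exact hx.2
        · exact hS i (by simp [hic, hi]) x hx.1)
    have key : (1 - PowerSeries.X ^ e c) * quotientSeries ℳ n₀ L N =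
        quotientSeries ℳ n₀ L (N ⊔ L.map (φ c)) -
          PowerSeries.X ^ e c * quotientSeries ℳ n₀ (L ⊓ N.comap (φ c)) N := by
      ext n
      have hdim := finrank_add_finrank_of_stable ℳ hfin (hφ c) hLh hNh (n₀ + n - e c)
      rw [show n₀ + n - e c + e c = n₀ + n by ring] at hdim
      rw [sub_mul, one_mul, map_sub, map_sub, PowerSeries.coeff_X_pow_mul',
        PowerSeries.coeff_X_pow_mul']
      simp only [quotientSeries, PowerSeries.coeff_mk]
      split_ifs with h
      · rw [Nat.cast_sub h, ← add_sub_assoc]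
        have : (_ : ℚ) = _ := congrArg (Nat.cast : ℕ → ℚ) hdim
        push_cast at this
        linarith
      -- The source degree lies below `n₀`, where T vanishes; this matches the zero coefficients of
      -- the shifted series.
      · have h₀ : L ⊓ ℳ (n₀ + n - e c) = ⊥ :=
          eq_bot_iff.2 ((inf_le_inf_right _ hLT).trans (hT₀ _ (by omega)).le)
        have h₁ : L ⊓ N.comap (φ c) ⊓ ℳ (n₀ + n - e c) = ⊥ :=
          eq_bot_iff.2 ((inf_le_inf_right _ inf_le_left).trans h₀.le)
        rw [h₀, h₁, finrank_bot, zero_add, zero_add] at hdim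
        rw [hdim]
    refine ⟨p - Polynomial.X ^ e c * q, ?_⟩
    rw [Finset.prod_insert hc, mul_assoc, mul_left_comm, key, mul_sub, hp, mul_left_comm, hq]
    push_cast
    ring

end HilbertSerre

/-! ### Growth of the coefficients of rational series -/

section Growth

open Filter Topology Polynomial

/-- With E the product of all `e i`, each factor 1 - X^(e i) divides 1 - X^E, so the denominator can
be taken with a single period. -/
theorem exists_one_sub_X_pow_mul_eq_polynomial {ι : Type*} (e : ι → ℕ) (he : ∀ i, 1 ≤ e i)
    (S : Finset ι) {F : PowerSeries ℚ} {p : ℚ[X]}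
    (h : (∏ i ∈ S, (1 - PowerSeries.X ^ e i)) * F = (p : PowerSeries ℚ)) :
    ∃ E r : ℕ, 1 ≤ E ∧ ∃ q : ℚ[X], (1 - PowerSeries.X ^ E) ^ r * F = (q : PowerSeries ℚ) := by
  refine ⟨∏ i ∈ S, e i, S.card, Finset.one_le_prod' fun i _ => he i, ?_⟩
  have hdvd : ∏ i ∈ S, (1 - (X : ℚ[X]) ^ e i) ∣ (1 - X ^ ∏ i ∈ S, e i) ^ S.card := by
    rw [← Finset.prod_const]
    refine Finset.prod_dvd_prod_of_dvd _ _ fun i hi => ?_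
    obtain ⟨c, hc⟩ := Finset.dvd_prod_of_mem e hi
    rw [hc, pow_mul]
    exact one_sub_dvd_one_sub_pow _ _
  obtain ⟨c, hc⟩ := hdvd
  refine ⟨c * p, ?_⟩
  have hc' := congrArg (fun q : ℚ[X] => (q : PowerSeries ℚ)) hc
  simp only [← Polynomial.coeToPowerSeries.ringHom_apply, map_mul, map_pow, map_sub, map_one,
    map_prod] at hc' h ⊢
  simp only [Polynomial.coeToPowerSeries.ringHom_apply, Polynomial.coe_X] at hc' h ⊢
  rw [hc', ← h]
  ring

/-- Partial sums of the coefficients correspond to division by `1 - X`. -/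
theorem one_sub_X_mul_mk_sum (h : ℕ → ℚ) :
    (1 - PowerSeries.X) * PowerSeries.mk (fun n => ∑ i ∈ Finset.range (n + 1), h i) =
      PowerSeries.mk h := by
  ext n
  rw [sub_mul, one_mul, map_sub]
  cases n with
  | zero => simp
  | succ n =>
    rw [PowerSeries.coeff_succ_X_mul]
    simp [Finset.sum_range_succ _ (n + 1)]

/-- Faulhaber's formula, applied to each monomial. -/
theorem exists_polynomial_sum_range (q : ℚ[X]) :
    ∃ Q : ℚ[X], ∀ n : ℕ, ∑ i ∈ Finset.range n, q.eval (i : ℚ) = Q.eval (n : ℚ) := by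
  induction q using Polynomial.induction_on' with
  | add p q hp hq =>
    obtain ⟨P, hP⟩ := hp
    obtain ⟨Q, hQ⟩ := hq
    exact ⟨P + Q, fun n => by simp [Finset.sum_add_distrib, hP, hQ]⟩
  | monomial d a =>
    refine ⟨C a * ∑ i ∈ Finset.range (d + 1),
      C (_root_.bernoulli i * ((d + 1).choose i) / (d + 1)) * X ^ (d + 1 - i), fun n => ?_⟩
    simp only [Polynomial.eval_monomial, ← Finset.mul_sum, sum_range_pow, Polynomial.eval_mul,
      Polynomial.eval_C, Polynomial.eval_finsetSum, Polynomial.eval_pow, Polynomial.eval_X]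
    congr 1
    exact Finset.sum_congr rfl fun i _ => by ring

/-- Multiplication by 1 - X^E takes differences along multiples of E, so each factor removed costs
one summation of a polynomial. The other residue classes are not needed, since the result is applied
to a monotone sequence. -/
theorem exists_polynomial_of_one_sub_X_pow {E : ℕ} (r : ℕ) :
    ∀ (G : PowerSeries ℚ) (p : ℚ[X]), (1 - PowerSeries.X ^ E) ^ r * G = (p : PowerSeries ℚ) →
      1 ≤ E → ∃ q : ℚ[X], ∀ᶠ n : ℕ in atTop, G.coeff (E * n) = q.eval (n : ℚ) := by
  induction r with
  | zero =>
    intro G p h hE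
    refine ⟨0, ?_⟩
    filter_upwards [eventually_gt_atTop p.natDegree] with n hn
    rw [pow_zero, one_mul] at h
    rw [h, Polynomial.coeff_coe, Polynomial.eval_zero]
    exact Polynomial.coeff_eq_zero_of_natDegree_lt (hn.trans_le (Nat.le_mul_of_pos_left n hE))
  | succ r ih =>
    intro G p h hE
    obtain ⟨q, hq⟩ := ih ((1 - PowerSeries.X ^ E) * G) p (by rw [← mul_assoc, ← pow_succ, h]) hE
    obtain ⟨N, hN⟩ := eventually_atTop.1 hq
    obtain ⟨Q, hQ⟩ := exists_polynomial_sum_range (q.comp (X + 1))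
    refine ⟨Q + C (G.coeff (E * N) - Q.eval (N : ℚ)), eventually_atTop.2 ⟨N, fun n hn => ?_⟩⟩
    induction n, hn using Nat.le_induction with
    | base => simp
    | succ n hn ih' =>
      have h₁ := hN (n + 1) (by omega)
      rw [sub_mul, one_mul, map_sub, PowerSeries.coeff_X_pow_mul', if_pos (Nat.le_mul_of_pos_right E n.succ_pos),
        show E * (n + 1) - E = E * n by rw [mul_add, mul_one, Nat.add_sub_cancel]] at h₁
      have h₂ := hQ (n + 1)
      rw [Finset.sum_range_succ, hQ n, Polynomial.eval_comp, Polynomial.eval_add,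
        Polynomial.eval_X, Polynomial.eval_one] at h₂
      rw [Polynomial.eval_add, Polynomial.eval_C] at ih' ⊢
      push_cast at h₁ h₂ ⊢
      linarith

theorem growthExponent_le_of_le {f : ℕ → ℕ} {C : ℝ} {d : ℕ}
    (h : ∀ᶠ n : ℕ in atTop, (f n : ℝ) ≤ C * (n : ℝ) ^ d) : growthExponent f ≤ ((d : ℝ) : EReal) := by
  have hlog : Tendsto (fun n : ℕ => Real.log n) atTop atTop :=
    Real.tendsto_log_atTop.comp tendsto_natCast_atTop_atTop
  have hlim : Tendsto (fun n : ℕ => ((Real.log (max C 1) / Real.log n + d : ℝ) : EReal)) atTop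
      (𝓝 ((d : ℝ) : EReal)) := by
    refine (continuous_coe_real_ereal.tendsto _).comp ?_
    simpa using (hlog.const_div_atTop (Real.log (max C 1))).add_const (d : ℝ)
  rw [← hlim.limsup_eq]
  refine limsup_le_limsup ?_
  filter_upwards [h, eventually_gt_atTop 1] with n hn h1
  have hn1 : (1 : ℝ) < n := by exact_mod_cast h1
  have hl : 0 < Real.log n := Real.log_pos hn1
  rw [EReal.coe_le_coe_iff, div_add' _ _ _ hl.ne', div_le_div_iff_of_pos_right hl]
  -- The maximum makes the logarithm of the constant nonnegative, as required where `f n = 0` and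
  -- its logarithm is read as 0.
  have hC : (1 : ℝ) ≤ max C 1 := le_max_right _ _
  rcases Nat.eq_zero_or_pos (f n) with h0 | h0
  · rw [h0, Nat.cast_zero, Real.log_zero]
    exact add_nonneg (Real.log_nonneg hC) (mul_nonneg d.cast_nonneg hl.le)
  · rw [← Real.log_pow, ← Real.log_mul (by positivity) (by positivity)]
    refine Real.log_le_log (by exact_mod_cast h0) (hn.trans ?_)
    gcongr
    exact le_max_left _ _

theorem le_growthExponent_of_le {f : ℕ → ℕ} {c : ℝ} (hc : 0 < c) {d : ℕ}
    (h : ∀ᶠ n : ℕ in atTop, c * (n : ℝ) ^ d ≤ f n) : ((d : ℝ) : EReal) ≤ growthExponent f := by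
  have hlog : Tendsto (fun n : ℕ => Real.log n) atTop atTop :=
    Real.tendsto_log_atTop.comp tendsto_natCast_atTop_atTop
  have hlim : Tendsto (fun n : ℕ => ((Real.log c / Real.log n + d : ℝ) : EReal)) atTop
      (𝓝 ((d : ℝ) : EReal)) := by
    refine (continuous_coe_real_ereal.tendsto _).comp ?_
    simpa using (hlog.const_div_atTop (Real.log c)).add_const (d : ℝ)
  rw [← hlim.limsup_eq]
  refine limsup_le_limsup ?_
  filter_upwards [h, eventually_gt_atTop 1] with n hn h1
  have hn1 : (1 : ℝ) < n := by exact_mod_cast h1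
  have hl : 0 < Real.log n := Real.log_pos hn1
  rw [EReal.coe_le_coe_iff, div_add' _ _ _ hl.ne', div_le_div_iff_of_pos_right hl,
    ← Real.log_pow, ← Real.log_mul (by positivity) (by positivity)]
  exact Real.log_le_log (by positivity) hn

theorem growthExponent_nonneg (f : ℕ → ℕ) : 0 ≤ growthExponent f := by
  have : Tendsto (fun _ : ℕ => (0 : EReal)) atTop (𝓝 0) := tendsto_const_nhds
  rw [← this.limsup_eq]
  refine limsup_le_limsup (Eventually.of_forall fun n => ?_)
  exact EReal.coe_nonneg.2 (div_nonneg (Real.log_natCast_nonneg _) (Real.log_natCast_nonneg _))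

/-- A monotone function agreeing with a nonzero polynomial on large multiples of `E` has the growth
of a power. -/
theorem exists_growth_bounds {H : ℕ → ℕ} (hH : Monotone H) {E : ℕ} (hE : 1 ≤ E) {q : ℚ[X]}
    (hq : ∀ᶠ n : ℕ in atTop, (H (E * n) : ℚ) = q.eval (n : ℚ)) (hq0 : q ≠ 0) :
    ∃ d : ℕ, ∃ c C : ℝ, 0 < c ∧ 0 < C ∧
      ∀ᶠ n : ℕ in atTop, c * (n : ℝ) ^ d ≤ H n ∧ (H n : ℝ) ≤ C * (n : ℝ) ^ d := by
  set P : ℝ[X] := q.map (algebraMap ℚ ℝ) with hP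
  have hP0 : P ≠ 0 := (Polynomial.map_ne_zero_iff (algebraMap ℚ ℝ).injective).2 hq0
  have hHP : ∀ᶠ n : ℕ in atTop, (H (E * n) : ℝ) = P.eval (n : ℝ) := by
    filter_upwards [hq] with n hn
    have := congrArg (algebraMap ℚ ℝ) hn
    rw [← Polynomial.eval_map_apply] at this
    simpa [hP] using this
  set d := P.natDegree
  set l := P.leadingCoeff
  have hl0 : l ≠ 0 := Polynomial.leadingCoeff_ne_zero.2 hP0
  have hlim : Tendsto (fun n : ℕ => (H (E * n) : ℝ) / (n : ℝ) ^ d) atTop (𝓝 l) := by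
    have h₁ : Tendsto (fun x : ℝ => P.eval x / (X ^ d : ℝ[X]).eval x) atTop
        (𝓝 (P.leadingCoeff / (X ^ d : ℝ[X]).leadingCoeff)) :=
      Polynomial.div_tendsto_atTop_leadingCoeff_div_of_degree_eq _ _
        (by rw [Polynomial.degree_X_pow, Polynomial.degree_eq_natDegree hP0])
    simp only [Polynomial.eval_pow, Polynomial.eval_X, Polynomial.leadingCoeff_X_pow,
      div_one] at h₁
    refine (h₁.comp tendsto_natCast_atTop_atTop).congr' ?_
    filter_upwards [hHP] with n hn
    rw [hn, Function.comp_apply]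
  have hl : 0 < l := lt_of_le_of_ne (ge_of_tendsto hlim (Eventually.of_forall fun n => by
    positivity)) hl0.symm
  have hb : ∀ᶠ n : ℕ in atTop, l / 2 * (n : ℝ) ^ d ≤ H (E * n) ∧
      (H (E * n) : ℝ) ≤ 2 * l * (n : ℝ) ^ d := by
    filter_upwards [hlim.eventually (Icc_mem_nhds (by linarith : l / 2 < l)
      (by linarith : l < 2 * l)), eventually_gt_atTop 0] with n hn hn0
    have : (0 : ℝ) < (n : ℝ) ^ d := by positivity
    exact ⟨(le_div_iff₀ this).1 hn.1, (div_le_iff₀ this).1 hn.2⟩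
  have hE0 : (0 : ℝ) < E := by exact_mod_cast hE
  -- Monotonicity gives H(E⌊n/E⌋) ≤ H(n) ≤ H(En), and ⌊n/E⌋ ≥ n/(2E) once n ≥ E.
  refine ⟨d, l / 2 * (1 / (2 * E)) ^ d, 2 * l, by positivity, by positivity, ?_⟩
  have hdiv : Tendsto (fun n : ℕ => n / E) atTop atTop := Nat.tendsto_div_const_atTop (by omega)
  filter_upwards [hb, hdiv.eventually hb, eventually_ge_atTop E] with n h₁ h₂ hnE
  constructor
  · refine le_trans ?_ (h₂.1.trans (Nat.cast_le.2 (hH (Nat.mul_div_le n E))))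
    rw [mul_assoc, ← mul_pow]
    have h₃ : n ≤ 2 * E * (n / E) := by
      have h₄ := Nat.div_add_mod n E
      have h₅ := Nat.mod_lt n (by omega : E > 0)
      have h₆ : E ≤ E * (n / E) := Nat.le_mul_of_pos_right E (Nat.div_pos hnE (by omega))
      rw [mul_assoc]
      omega
    have h₄ : (n : ℝ) ≤ 2 * E * ((n / E : ℕ) : ℝ) := by exact_mod_cast h₃
    have h₅ : 1 / (2 * E) * (n : ℝ) ≤ ((n / E : ℕ) : ℝ) := by
      rw [one_div, inv_mul_le_iff₀ (by positivity)]
      exact h₄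
    gcongr
  · exact (Nat.cast_le.2 (hH (Nat.le_mul_of_pos_left n hE))).trans h₁.2

/-- If the generating series of `h` is rational with denominator a product of factors `1 - X ^ e`,
then the partial sums of `h` determine an integral growth exponent. -/
theorem exists_growth_degree {ι : Type*} (e : ι → ℕ) (he : ∀ i, 1 ≤ e i) (S : Finset ι)
    (h : ℕ → ℕ) {p : ℚ[X]}
    (hp : (∏ i ∈ S, (1 - PowerSeries.X ^ e i)) * PowerSeries.mk (fun n => (h n : ℚ)) =
      (p : PowerSeries ℚ)) :
    ∃ d : ℕ,
      (∀ (f : ℕ → ℕ) (a b : ℕ), (∀ n, f n ≤ ∑ i ∈ Finset.range (a + b * n + 1), h i) →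
        growthExponent f ≤ ((d : ℝ) : EReal)) ∧
      (∀ f : ℕ → ℕ, (∀ᶠ n in atTop, ∑ i ∈ Finset.range (n + 1), h i ≤ f n) →
        ((d : ℝ) : EReal) ≤ growthExponent f) := by
  obtain ⟨E, r, hE, q₀, hq₀⟩ := exists_one_sub_X_pow_mul_eq_polynomial e he S hp
  set H : ℕ → ℕ := fun n => ∑ i ∈ Finset.range (n + 1), h i with hHdef
  have hH : Monotone H := fun m n hmn =>
    Finset.sum_le_sum_of_subset (Finset.range_mono (by omega))
  obtain ⟨q, hq⟩ : ∃ q : ℚ[X], ∀ᶠ n : ℕ in atTop, (H (E * n) : ℚ) = q.eval (n : ℚ) := by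
    -- Passing to partial sums divides by 1 - X, which costs one more factor 1 - X^E.
    obtain ⟨c, hc⟩ : (1 - X : ℚ[X]) ∣ 1 - X ^ E := one_sub_dvd_one_sub_pow _ _
    have hc' := congrArg (fun q : ℚ[X] => (q : PowerSeries ℚ)) hc
    have := exists_polynomial_of_one_sub_X_pow (E := E) (r + 1)
      (PowerSeries.mk fun n => ∑ i ∈ Finset.range (n + 1), (h i : ℚ)) (c * q₀) (by
        simp only [← Polynomial.coeToPowerSeries.ringHom_apply, map_mul, map_pow, map_sub,
          map_one] at hc' hq₀ ⊢
        simp only [Polynomial.coeToPowerSeries.ringHom_apply, Polynomial.coe_X] at hc' hq₀ ⊢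
        rw [← hq₀, ← one_sub_X_mul_mk_sum fun i => (h i : ℚ), pow_succ]
        nth_rw 2 [hc']
        ring) hE
    simpa [hHdef] using this
  -- If q = 0, the monotone H vanishes at arbitrarily large arguments, hence everywhere, and the
  -- exponent is 0.
  by_cases hq0 : q = 0
  · have hzero : ∀ n, H n = 0 := by
      intro n
      obtain ⟨m, hm, hm'⟩ := (hq.and (eventually_ge_atTop n)).exists
      rw [hq0, Polynomial.eval_zero, Nat.cast_eq_zero] at hm
      exact Nat.le_zero.1 (hm ▸ hH (hm'.trans (Nat.le_mul_of_pos_left m hE)))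
    refine ⟨0, fun f a b hf => ?_, fun f _ => by simpa using growthExponent_nonneg f⟩
    refine growthExponent_le_of_le (C := 1) (Eventually.of_forall fun n => ?_)
    have : f n = 0 := Nat.le_zero.1 ((hf n).trans (hzero _).le)
    simp [this]
  · obtain ⟨d, c, C, hc, hC, hb⟩ := exists_growth_bounds hH hE hq hq0
    refine ⟨d, fun f a b hf => ?_, fun f hf => ?_⟩
    · refine growthExponent_le_of_le (C := C * (a + b + 1) ^ d) ?_
      have ht : Tendsto (fun n : ℕ => (a + b + 1) * n) atTop atTop :=
        tendsto_id.const_mul_atTop' (by omega)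
      filter_upwards [ht.eventually hb, eventually_ge_atTop 1] with n hn h1
      have h₁ : f n ≤ H ((a + b + 1) * n) := (hf n).trans (hH (by nlinarith))
      rw [mul_assoc, ← mul_pow]
      refine (Nat.cast_le.2 h₁).trans (hn.2.trans ?_)
      push_cast
      exact le_rfl
    · refine le_growthExponent_of_le hc ?_
      filter_upwards [hb, hf] with n h₁ h₂
      exact h₁.1.trans (Nat.cast_le.2 h₂)

end Growth

/-! ### Spans of products in right modules -/

section RightMul

variable {k A M : Type*} [Field k] [Ring A] [Algebra k A] [AddCommGroup M] [Module k M]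
  [Module Aᵐᵒᵖ M]

theorem op_smul_mem_rightMulSpan {F : Submodule k M} {W : Submodule k A} {m : M} {a : A}
    (hm : m ∈ F) (ha : a ∈ W) : op a • m ∈ rightMulSpan F W :=
  Submodule.subset_span ⟨m, hm, a, ha, rfl⟩

theorem rightMulSpan_le {F L : Submodule k M} {W : Submodule k A} :
    rightMulSpan F W ≤ L ↔ ∀ m ∈ F, ∀ a ∈ W, op a • m ∈ L := by
  refine ⟨fun h m hm a ha => h (op_smul_mem_rightMulSpan hm ha), fun h => ?_⟩
  rw [rightMulSpan, Submodule.span_le]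
  rintro _ ⟨m, hm, a, ha, rfl⟩
  exact h m hm a ha

variable [IsScalarTower k Aᵐᵒᵖ M]

variable (k A M) in
/-- The action of `A` on a right module, as a bilinear map. -/
def rightMul : A →ₗ[k] M →ₗ[k] M :=
  (Algebra.lsmul k k M : Aᵐᵒᵖ →ₐ[k] Module.End k M).toLinearMap ∘ₗ
    (opLinearEquiv k : A ≃ₗ[k] Aᵐᵒᵖ).toLinearMap

theorem rightMul_apply (a : A) (m : M) : rightMul k A M a m = op a • m := rfl

theorem rightMulSpan_fg {F : Submodule k M} {W : Submodule k A} (hF : F.FG) (hW : W.FG) :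
    (rightMulSpan F W).FG := by
  have : rightMulSpan F W = Submodule.map₂ (rightMul k A M) W F :=
    le_antisymm
      (rightMulSpan_le.2 fun m hm a ha => Submodule.apply_mem_map₂ (rightMul k A M) ha hm)
      (Submodule.map₂_le.2 fun a ha m hm => op_smul_mem_rightMulSpan hm ha)
  rw [this]
  exact hW.map₂ _ hF

/-- Together with the reverse inclusion below, this is associativity F(WV) = (FW)V. -/
theorem rightMulSpan_mul_le (F : Submodule k M) (W V : Submodule k A) :
    rightMulSpan F (W * V) ≤ rightMulSpan (rightMulSpan F W) V := by
  refine rightMulSpan_le.2 fun m hm a ha => ?_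
  have : W * V ≤ (rightMulSpan (rightMulSpan F W) V).comap ((rightMul k A M).flip m) :=
    Submodule.mul_le.2 fun w hw v hv => by
      rw [Submodule.mem_comap, LinearMap.flip_apply, rightMul_apply, op_mul, mul_smul]
      exact op_smul_mem_rightMulSpan (op_smul_mem_rightMulSpan hm hw) hv
  exact this ha

theorem rightMulSpan_rightMulSpan_le (F : Submodule k M) (W V : Submodule k A) :
    rightMulSpan (rightMulSpan F W) V ≤ rightMulSpan F (W * V) := by
  refine rightMulSpan_le.2 fun x hx a ha => ?_
  have : rightMulSpan F W ≤ (rightMulSpan F (W * V)).comap (rightMul k A M a) :=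
    rightMulSpan_le.2 fun m hm w hw => by
      rw [Submodule.mem_comap, rightMul_apply, ← mul_smul, ← op_mul]
      exact op_smul_mem_rightMulSpan hm (Submodule.mul_mem_mul hw ha)
  exact this hx

theorem rightMulSpan_mono {F F' : Submodule k M} {W W' : Submodule k A} (hF : F ≤ F')
    (hW : W ≤ W') : rightMulSpan F W ≤ rightMulSpan F' W' :=
  rightMulSpan_le.2 fun _ hm _ ha => op_smul_mem_rightMulSpan (hF hm) (hW ha)

theorem eq_top_of_op_smul_mem {F L : Submodule k M}
    (hF : Submodule.span Aᵐᵒᵖ (F : Set M) = ⊤) (hFL : F ≤ L)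
    (hL : ∀ a : A, ∀ x ∈ L, op a • x ∈ L) : L = ⊤ := by
  let L' : Submodule Aᵐᵒᵖ M := { L with smul_mem' := fun a x hx => hL (unop a) x hx }
  have : Submodule.span Aᵐᵒᵖ (F : Set M) ≤ L' := Submodule.span_le.2 hFL
  rw [hF] at this
  exact eq_top_iff.2 fun x _ => this (Submodule.mem_top (x := x))

end RightMul

/-! ### Generation in bounded degrees and central action in large degrees -/

section GradedModule

variable {k A M : Type*} [Field k] [Ring A] [Algebra k A] [AddCommGroup M] [Module k M]
  [Module Aᵐᵒᵖ M] [IsScalarTower k Aᵐᵒᵖ M] (𝒜 : ℕ → Submodule k A) [GradedAlgebra 𝒜]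
  (ℳ : ℤ → Submodule k M)

/-- `A` is generated as an algebra by its homogeneous elements of degree at most `d`. -/
def IsGeneratedInDegreeLE (d : ℕ) : Prop :=
  ∀ R : Subalgebra k A, (∀ j ≤ d, ∀ a ∈ 𝒜 j, a ∈ R) → ∀ a, a ∈ R

theorem exists_isGeneratedInDegreeLE (hfg : Algebra.FiniteType k A) :
    ∃ d, IsGeneratedInDegreeLE 𝒜 d := by
  obtain ⟨S, hS⟩ := hfg.out
  obtain ⟨s, hs⟩ := exists_finset_of_fg 𝒜 (F := Submodule.span k (S : Set A)) ⟨S, rfl⟩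
  refine ⟨s.sup id, fun R hR => ?_⟩
  have hSR : Algebra.adjoin k (S : Set A) ≤ R := by
    refine Algebra.adjoin_le fun x hx => mem_of_gradedProj_mem 𝒜 (L := R.toSubmodule) fun i => ?_
    by_cases hi : i ∈ s
    · exact hR i (Finset.le_sup (f := id) hi) _ (gradedProj_mem 𝒜 i x)
    · rw [hs x (Submodule.subset_span hx) i hi]
      exact zero_mem _
  rw [hS] at hSR
  exact fun a => hSR Algebra.mem_top

-- The elements of A that map `L` into itself form a subalgebra, so generators suffice.
variable {𝒜} in
theorem IsGeneratedInDegreeLE.op_smul_mem {d : ℕ} (hd : IsGeneratedInDegreeLE 𝒜 d)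
    {L : Submodule k M} (hL : ∀ j ≤ d, ∀ a ∈ 𝒜 j, ∀ x ∈ L, op a • x ∈ L) (a : A) (x : M)
    (hx : x ∈ L) : op a • x ∈ L := by
  let R : Subalgebra k A :=
    { carrier := {a | ∀ x ∈ L, op a • x ∈ L}
      mul_mem' := fun {a b} ha hb x hx => by
        rw [op_mul, mul_smul]; exact hb _ (ha x hx)
      add_mem' := fun {a b} ha hb x hx => by
        rw [op_add, add_smul]; exact add_mem (ha x hx) (hb x hx)
      algebraMap_mem' := fun r x hx => by
        change rightMul k A M (algebraMap k A r) x ∈ L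
        rw [Algebra.algebraMap_eq_smul_one, map_smul, LinearMap.smul_apply, rightMul_apply, op_one,
          one_smul]
        exact L.smul_mem r hx }
  exact hd R (fun j hj a ha x hx => hL j hj a ha x hx) a x hx

theorem gradedProj_op_smul [DirectSum.Decomposition ℳ]
    (hℳ : ∀ (i : ℕ) (j : ℤ), ∀ a ∈ 𝒜 i, ∀ m ∈ ℳ j, op a • m ∈ ℳ (j + i)) {i : ℕ} {a : A}
    (ha : a ∈ 𝒜 i) (n : ℤ) (x : M) :
    gradedProj ℳ n (op a • x) = op a • gradedProj ℳ (n - i) x := by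
  have := gradedProj_add_of_map_le ℳ (f := rightMul k A M a) (c := i)
    (fun n x hx => hℳ i n a ha x hx) (n - i) x
  rwa [sub_add_cancel] at this

/-- The properties of a locally finite graded right module that is bounded below, generated in
bounded degrees, and on whose components of large degree the elements of `A` of even degree act
centrally. -/
structure HasCentralTail (b d n₀ : ℕ) : Prop where
  smul_mem : ∀ (i : ℕ) (j : ℤ), ∀ a ∈ 𝒜 i, ∀ m ∈ ℳ j, op a • m ∈ ℳ (j + i)
  finite : GradedLocallyFinite ℳ
  eq_bot : ∀ n < -(b : ℤ), ℳ n = ⊥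
  generated : ∀ n ≥ (n₀ : ℤ), ℳ n ≤ ⨆ j ∈ Finset.Icc 1 d, rightMulSpan (ℳ (n - j)) (𝒜 j)
  comm : ∀ n ≥ (n₀ : ℤ), ∀ x ∈ ℳ n, ∀ j, Even j → ∀ c ∈ 𝒜 j, ∀ a : A,
    op a • op c • x = op c • op a • x

-- If a finite dimensional F generates M, then M_n is contained in F_n A_0 plus the sum of the
-- M_{n-j} A_j with 1 ≤ j ≤ d. The first term is zero for all but finitely many n, and finite
-- dimensionality follows by induction on n from the lower bound.
variable {𝒜} in
theorem exists_generated_bounded [DirectSum.Decomposition ℳ] [Module.Finite Aᵐᵒᵖ M]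
    (hfin : GradedLocallyFinite 𝒜) {d : ℕ} (hd : IsGeneratedInDegreeLE 𝒜 d)
    (hℳ : ∀ (i : ℕ) (j : ℤ), ∀ a ∈ 𝒜 i, ∀ m ∈ ℳ j, op a • m ∈ ℳ (j + i)) :
    GradedLocallyFinite ℳ ∧ ∃ b n₁ : ℕ, (∀ n < -(b : ℤ), ℳ n = ⊥) ∧
      ∀ n > (n₁ : ℤ), ℳ n ≤ ⨆ j ∈ Finset.Icc 1 d, rightMulSpan (ℳ (n - j)) (𝒜 j) := by
  obtain ⟨S, hS⟩ := Module.Finite.fg_top (R := Aᵐᵒᵖ) (M := M)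
  set F := Submodule.span k (S : Set M) with hF
  have hFfg : F.FG := ⟨S, rfl⟩
  have hFtop : Submodule.span Aᵐᵒᵖ (F : Set M) = ⊤ := by
    rw [eq_top_iff, ← hS]
    exact Submodule.span_mono Submodule.subset_span
  obtain ⟨s, hs⟩ := exists_finset_of_fg ℳ hFfg
  let D (n : ℤ) : Submodule k M := ⨆ j ∈ Finset.Icc 1 d, rightMulSpan (ℳ (n - j)) (𝒜 j)
  let E (n : ℤ) : Submodule k M := rightMulSpan (F.map (gradedProj ℳ n)) (𝒜 0)
  have hgen : ∀ n, ℳ n ≤ E n ⊔ D n := by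
    -- The elements all of whose components satisfy the inclusion form a subspace that contains F
    -- and is stable under homogeneous elements of degree at most d. Degree 0 preserves `E n` and `D
    -- n` separately; positive degree lands in `D n`.
    have : ⨅ n, (E n ⊔ D n).comap (gradedProj ℳ n) = ⊤ := by
      refine eq_top_of_op_smul_mem hFtop (le_iInf fun n x hx => ?_)
        (hd.op_smul_mem (fun j hj a ha x hx => ?_))
      · refine Submodule.mem_sup_left ?_
        have := op_smul_mem_rightMulSpan (Submodule.mem_map_of_mem (f := gradedProj ℳ n) hx)
          (SetLike.GradedOne.one_mem (A := 𝒜))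
        rwa [op_one, one_smul] at this
      · rw [Submodule.mem_iInf] at hx ⊢
        intro n
        rw [Submodule.mem_comap, gradedProj_op_smul 𝒜 ℳ hℳ ha]
        rcases Nat.eq_zero_or_pos j with rfl | hj0
        · obtain ⟨y, hy, z, hz, hyz⟩ := Submodule.mem_sup.1 (hx n)
          rw [Nat.cast_zero, sub_zero, ← hyz, smul_add]
          have h00 : 𝒜 0 * 𝒜 0 ≤ 𝒜 0 :=
            Submodule.mul_le.2 fun u hu v hv => by simpa using SetLike.mul_mem_graded hu hv
          refine add_mem (Submodule.mem_sup_left ?_) (Submodule.mem_sup_right ?_)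
          · exact rightMulSpan_mono le_rfl h00
              (rightMulSpan_rightMulSpan_le _ _ _ (op_smul_mem_rightMulSpan hy ha))
          · have : D n ≤ (D n).comap (rightMul k A M a) := by
              refine iSup₂_le fun i hi => rightMulSpan_le.2 fun m hm w hw => ?_
              refine Submodule.mem_iSup_of_mem i (Submodule.mem_iSup_of_mem hi ?_)
              rw [rightMul_apply, ← mul_smul, ← op_mul]
              exact op_smul_mem_rightMulSpan hm (by simpa using SetLike.mul_mem_graded hw ha)
            exact this hz
        · exact Submodule.mem_sup_right (Submodule.mem_iSup_of_mem j (Submodule.mem_iSup_of_mem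
            (Finset.mem_Icc.2 ⟨hj0, hj⟩) (op_smul_mem_rightMulSpan (gradedProj_mem ℳ _ _) ha)))
    intro n x hx
    have hx' := (Submodule.mem_iInf _).1 (this ▸ Submodule.mem_top (x := x)) n
    rwa [Submodule.mem_comap, gradedProj_of_mem ℳ hx] at hx'
  have hE : ∀ n ∉ s, E n = ⊥ := fun n hn => eq_bot_iff.2 <| rightMulSpan_le.2 <| by
    rintro _ ⟨x, hx, rfl⟩ a -
    rw [hs x hx n hn, smul_zero]
    exact zero_mem _
  have hEfg : ∀ n, (E n).FG := fun n =>
    rightMulSpan_fg (hFfg.map _) ((Submodule.fg_iff_finiteDimensional _).2 (hfin 0))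
  obtain ⟨u, hu⟩ := s.bddAbove
  obtain ⟨l, hl⟩ := s.bddBelow
  have hbot : ∀ n < -((-l).toNat : ℤ), ℳ n = ⊥ := by
    have : ⨅ n, ⨅ (_ : n < -((-l).toNat : ℤ)), LinearMap.ker (gradedProj ℳ n) = ⊤ := by
      refine eq_top_of_op_smul_mem hFtop (le_iInf₂ fun n hn x hx => ?_)
        (hd.op_smul_mem (fun j hj a ha x hx => ?_))
      · exact hs x hx n fun h => by
          have := hl h
          omega
      · simp only [Submodule.mem_iInf] at hx ⊢
        intro n hn
        rw [LinearMap.mem_ker, gradedProj_op_smul 𝒜 ℳ hℳ ha, hx (n - j) (by omega), smul_zero]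
    intro n hn
    refine eq_bot_iff.2 fun x hx => ?_
    have hx' := this ▸ Submodule.mem_top (x := x)
    simp only [Submodule.mem_iInf] at hx'
    replace hx' := hx' n hn
    rwa [LinearMap.mem_ker, gradedProj_of_mem ℳ hx] at hx'
  refine ⟨?_, (-l).toNat, u.toNat, hbot, fun n hn => ?_⟩
  · have hind : ∀ N : ℕ, ∀ n : ℤ, n + (-l).toNat < N → (ℳ n).FG := by
      intro N
      induction N with
      | zero =>
        intro n hn
        rw [hbot n (by push_cast at hn; omega)]
        exact Submodule.fg_bot
      | succ N ih =>
        intro n hn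
        rw [← Submodule.fg_top]
        have hED : (E n ⊔ D n).FG := (hEfg n).sup (Submodule.fg_biSup _ _ fun j hj =>
          rightMulSpan_fg (ih _ (by rw [Finset.mem_Icc] at hj; push_cast at hn; omega))
            ((Submodule.fg_iff_finiteDimensional _).2 (hfin j)))
        have : FiniteDimensional k ↥(E n ⊔ D n) := (Submodule.fg_iff_finiteDimensional _).1 hED
        exact (Submodule.finiteDimensional_of_le (hgen n)).fg_top
    exact fun n => (Submodule.fg_iff_finiteDimensional _).1
      (hind (n + (-l).toNat + 1).toNat n (by omega))
  · have := hgen n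
    rwa [hE n fun h => by
      have := hu h
      omega, bot_sup_eq] at this

-- Splitting off a positive-degree factor twice writes an element of large degree as a sum of terms
-- m(vw) with vw of degree at least 2. The identity (vw)(ca) = (vw)(ac) then makes c central on it.
variable {𝒜} in
theorem exists_hasCentralTail [DirectSum.Decomposition ℳ] [Module.Finite Aᵐᵒᵖ M]
    (hfin : GradedLocallyFinite 𝒜)
    (hperm : ∀ i, 2 ≤ i → ∀ x ∈ 𝒜 i, ∀ j, Even j → ∀ c ∈ 𝒜 j, ∀ a : A, x * (c * a) = x * (a * c))
    {d : ℕ} (hd : IsGeneratedInDegreeLE 𝒜 d)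
    (hℳ : ∀ (i : ℕ) (j : ℤ), ∀ a ∈ 𝒜 i, ∀ m ∈ ℳ j, op a • m ∈ ℳ (j + i)) :
    ∃ b n₀ : ℕ, HasCentralTail 𝒜 ℳ b d n₀ := by
  obtain ⟨hfin', b, n₁, hb, hgen⟩ := exists_generated_bounded ℳ hfin hd hℳ
  -- The first factor lowers the degree by at most d, which must leave it above `n₁` for the second
  -- splitting.
  refine ⟨b, n₁ + d + 1, hℳ, hfin', hb, fun n hn => hgen n (by push_cast at hn; omega), ?_⟩
  intro n hn x hx j hj c hc a
  push_cast at hn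
  let K : Submodule k M := LinearMap.ker
    (rightMul k A M a ∘ₗ rightMul k A M c - rightMul k A M c ∘ₗ rightMul k A M a)
  have hK : ℳ n ≤ K := by
    refine (hgen n (by omega)).trans (iSup₂_le fun i hi => ?_)
    rw [Finset.mem_Icc] at hi
    refine rightMulSpan_le.2 fun y hy w hw => ?_
    have hKw : ℳ (n - i) ≤ K.comap (rightMul k A M w) := by
      refine (hgen (n - i) (by omega)).trans (iSup₂_le fun i' hi' => ?_)
      refine rightMulSpan_le.2 fun m hm v hv => ?_
      rw [Finset.mem_Icc] at hi'
      have := hperm (i' + i) (by omega) (v * w) (SetLike.mul_mem_graded hv hw) j hj c hc a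
      rw [Submodule.mem_comap, LinearMap.mem_ker, LinearMap.sub_apply, sub_eq_zero]
      simp only [LinearMap.comp_apply, rightMul_apply, ← mul_smul, ← op_mul]
      rw [mul_assoc (v * w), mul_assoc (v * w), this]
    exact hKw hy
  have := hK hx
  rwa [LinearMap.mem_ker, LinearMap.sub_apply, sub_eq_zero] at this

end GradedModule

theorem finrank_biSup_of_iSupIndep {k M ι : Type*} [Field k] [AddCommGroup M] [Module k M]
    {N : ι → Submodule k M} (hN : iSupIndep N) (hfin : ∀ i, FiniteDimensional k (N i))
    (s : Finset ι) :
    Module.finrank k ↥(⨆ i ∈ s, N i) = ∑ i ∈ s, Module.finrank k (N i) := by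
  classical
  induction s using Finset.induction_on with
  | empty =>
    rw [Finset.sum_empty, show (⨆ i ∈ (∅ : Finset ι), N i) = ⊥ by simp, finrank_bot]
  | insert a s ha ih =>
    have : FiniteDimensional k ↥(⨆ i ∈ s, N i) :=
      (Submodule.fg_iff_finiteDimensional _).1 (Submodule.fg_biSup s N fun i _ =>
        (Submodule.fg_iff_finiteDimensional _).2 (hfin i))
    have := hfin a
    have hdis : N a ⊓ ⨆ i ∈ s, N i = ⊥ := (hN.disjoint_biSup (y := (s : Set ι)) ha).eq_bot
    have h := Submodule.finrank_sup_add_finrank_inf_eq (N a) (⨆ i ∈ s, N i)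
    rw [hdis, finrank_bot, add_zero, ih] at h
    rw [Finset.iSup_insert, Finset.sum_insert ha, h]

/-! ### Consequences of a central tail: noetherianity, Hilbert series, GK-dimension -/

section CentralTail

variable {k A M : Type*} [Field k] [Ring A] [Algebra k A] [AddCommGroup M] [Module k M]
  [Module Aᵐᵒᵖ M] [IsScalarTower k Aᵐᵒᵖ M] {𝒜 : ℕ → Submodule k A} [GradedAlgebra 𝒜]
  {ℳ : ℤ → Submodule k M}

/-- The sum of the components of degree at least `n₀`. -/
def gradedTail (ℳ : ℤ → Submodule k M) (n₀ : ℕ) : Submodule k M :=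
  ⨆ n ∈ Set.Ici (n₀ : ℤ), ℳ n

/-- The sum of the components of degrees from `-b` to `m - b`. -/
def gradedInitial (ℳ : ℤ → Submodule k M) (b m : ℕ) : Submodule k M :=
  ⨆ i ∈ Finset.range (m + 1), ℳ (i - b)

theorem le_gradedTail {n₀ : ℕ} {n : ℤ} (hn : (n₀ : ℤ) ≤ n) : ℳ n ≤ gradedTail ℳ n₀ :=
  le_iSup₂_of_le n hn le_rfl

/-- The index set of a basis of the components of `A` of degrees `2, 4, …, 2 d`. -/
abbrev EvenIndex (𝒜 : ℕ → Submodule k A) (d : ℕ) : Type :=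
  Σ j : Fin d, Fin (Module.finrank k (𝒜 (2 * (j + 1))))

variable (M) in
/-- Right multiplication by the elements of bases of the components of degrees `2, 4, …, 2 d`. -/
noncomputable def evenMul (hfin : GradedLocallyFinite 𝒜) (d : ℕ) (i : EvenIndex 𝒜 d) :
    M →ₗ[k] M :=
  have := hfin (2 * (i.1 + 1))
  rightMul k A M (Module.finBasis k (𝒜 (2 * (i.1 + 1))) i.2 : A)

theorem isStable_evenMul_iff (hfin : GradedLocallyFinite 𝒜) {d : ℕ} {L : Submodule k M} :
    IsStable (evenMul M hfin d) L ↔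
      ∀ j < d, ∀ c ∈ 𝒜 (2 * (j + 1)), ∀ x ∈ L, op c • x ∈ L := by
  refine ⟨fun h j hj c hc x hx => ?_, fun h i x hx => h i.1 i.1.2 _ (Subtype.property _) x hx⟩
  have := hfin (2 * (j + 1))
  let B := Module.finBasis k (𝒜 (2 * (j + 1)))
  let K : Submodule k (𝒜 (2 * (j + 1))) :=
    L.comap ((rightMul k A M).flip x ∘ₗ (𝒜 (2 * (j + 1))).subtype)
  have hK : ⊤ ≤ K := by
    rw [← B.span_eq, Submodule.span_le]
    rintro _ ⟨i, rfl⟩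
    exact h ⟨⟨j, hj⟩, i⟩ x hx
  exact hK (Submodule.mem_top (x := ⟨c, hc⟩))

namespace HasCentralTail

variable {b d n₀ : ℕ} (h : HasCentralTail 𝒜 ℳ b d n₀)
include h

theorem op_smul_mem_gradedTail {j : ℕ} {c : A} (hc : c ∈ 𝒜 j) {x : M}
    (hx : x ∈ gradedTail ℳ n₀) : op c • x ∈ gradedTail ℳ n₀ := by
  have : gradedTail ℳ n₀ ≤ (gradedTail ℳ n₀).comap (rightMul k A M c) :=
    iSup₂_le fun n hn y hy => le_gradedTail (le_add_of_le_of_nonneg hn (by positivity))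
      (h.smul_mem j n c hc y hy)
  exact this hx

theorem comm_gradedTail {j : ℕ} (hj : Even j) {c : A} (hc : c ∈ 𝒜 j) {x : M}
    (hx : x ∈ gradedTail ℳ n₀) (a : A) : op a • op c • x = op c • op a • x := by
  have : gradedTail ℳ n₀ ≤ LinearMap.ker
      (rightMul k A M a ∘ₗ rightMul k A M c - rightMul k A M c ∘ₗ rightMul k A M a) :=
    iSup₂_le fun n hn y hy => by
      rw [LinearMap.mem_ker, LinearMap.sub_apply, sub_eq_zero]
      exact h.comm n hn y hy j hj c hc a
  have hx' := this hx
  rwa [LinearMap.mem_ker, LinearMap.sub_apply, sub_eq_zero] at hx'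

theorem gradedTail_le {L : Submodule k M} (hU : ∀ n : ℤ, n₀ ≤ n → n ≤ n₀ + 2 * d → ℳ n ≤ L)
    (hL : ∀ j < d, ∀ c ∈ 𝒜 (2 * (j + 1)), ∀ x ∈ L, op c • x ∈ L) : gradedTail ℳ n₀ ≤ L := by
  have hL' : ∀ i, 1 ≤ i → i ≤ 2 * d → Even i → ∀ c ∈ 𝒜 i, ∀ x ∈ L, op c • x ∈ L := by
    rintro i h1 h2 ⟨j, rfl⟩ c hc x hx
    exact hL (j - 1) (by omega) c (by rwa [show 2 * (j - 1 + 1) = j + j by omega]) x hx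
  -- `R` consists of the x in L and in the tail with xw in L for all odd w of degree at most d. It
  -- is stable under all generators of positive degree: an even generator commutes with w, and an
  -- odd one makes a product with w of even degree at most 2d. Asking only for x in L would not
  -- suffice, since L need not be stable under odd elements.
  let R : Submodule k M := L ⊓ gradedTail ℳ n₀ ⊓
    ⨅ j, ⨅ (_ : j ≤ d ∧ Odd j), ⨅ w ∈ 𝒜 j, L.comap (rightMul k A M w)
  have hR : ∀ x, x ∈ R ↔ (x ∈ L ∧ x ∈ gradedTail ℳ n₀) ∧
      ∀ j, j ≤ d ∧ Odd j → ∀ w ∈ 𝒜 j, op w • x ∈ L := fun x => by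
    simp only [R, Submodule.mem_inf, Submodule.mem_iInf, Submodule.mem_comap, rightMul_apply]
  have hRmul : ∀ i, 1 ≤ i → i ≤ d → ∀ a ∈ 𝒜 i, ∀ x ∈ R, op a • x ∈ R := by
    intro i h1 h2 a ha x hx
    rw [hR] at hx ⊢
    obtain ⟨⟨hxL, hxT⟩, hx⟩ := hx
    rcases Nat.even_or_odd i with hi | hi
    · refine ⟨⟨hL' i h1 (by omega) hi a ha x hxL, h.op_smul_mem_gradedTail ha hxT⟩, ?_⟩
      intro j hj w hw
      rw [h.comm_gradedTail hi ha hxT]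
      exact hL' i h1 (by omega) hi a ha _ (hx j hj w hw)
    · refine ⟨⟨hx i ⟨h2, hi⟩ a ha, h.op_smul_mem_gradedTail ha hxT⟩, ?_⟩
      intro j hj w hw
      rw [← mul_smul, ← op_mul]
      exact hL' (i + j) (by omega) (by omega) (hi.add_odd hj.2) _
        (SetLike.mul_mem_graded ha hw) x hxL
  have hind : ∀ N : ℕ, ∀ n : ℤ, n₀ ≤ n → n < n₀ + N → ℳ n ≤ R := by
    intro N
    induction N with
    | zero => intro n h1 h2; omega
    | succ N ih =>
      intro n h1 h2
      push_cast at h2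
      -- Multiplying by w adds at most d to the degree, so the window up to `n₀ + 2 * d` in L puts
      -- the components up to `n₀ + d` in R. Higher components come from lower ones by
      -- `h.generated`.
      by_cases hn : n ≤ n₀ + d
      · intro x hx
        rw [hR]
        refine ⟨⟨hU n h1 (by omega) hx, le_gradedTail h1 hx⟩, fun j hj w hw => ?_⟩
        exact hU (n + j) (by omega) (by omega) (h.smul_mem j n w hw x hx)
      · refine (h.generated n h1).trans (iSup₂_le fun j hj => rightMulSpan_le.2 ?_)
        rw [Finset.mem_Icc] at hj
        exact fun m hm a ha => hRmul j hj.1 hj.2 a ha m (ih (n - j) (by omega) (by omega) hm)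
  exact iSup₂_le fun n hn x hx =>
    ((hR x).1 (hind ((n - n₀).toNat + 1) n hn (by push_cast; omega) hx)).1.1

theorem exists_fg_generating_evenMul (hfin : GradedLocallyFinite 𝒜) :
    ∀ L ≤ gradedTail ℳ n₀, IsStable (evenMul M hfin d) L →
      ∃ F ≤ L, F.FG ∧ ∀ L', F ≤ L' → IsStable (evenMul M hfin d) L' → L ≤ L' := by
  intro L hLT hL
  refine exists_fg_generating (evenMul M hfin d) (T := gradedTail ℳ n₀)
    (U := ⨆ n ∈ Finset.Icc (n₀ : ℤ) (n₀ + 2 * d), ℳ n) ?_ ?_ ?_ ?_ ?_ hLT hL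
  · exact (isStable_evenMul_iff hfin).2 fun j _ c hc x hx => h.op_smul_mem_gradedTail hc hx
  · exact fun i j x hx => h.comm_gradedTail (even_two_mul _) (Subtype.property _) hx _
  · exact Submodule.fg_biSup _ _ fun n _ => (Submodule.fg_iff_finiteDimensional _).2 (h.finite n)
  · exact iSup₂_le fun n hn => le_gradedTail (Finset.mem_Icc.1 hn).1
  · exact fun L' hUL' hL' => h.gradedTail_le
      (fun n h1 h2 => (le_iSup₂_of_le n (Finset.mem_Icc.2 ⟨h1, h2⟩) le_rfl).trans hUL')
      ((isStable_evenMul_iff hfin).1 hL')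

variable [DirectSum.Decomposition ℳ]

theorem gradedInitial_sup_gradedTail : gradedInitial ℳ b (b + n₀) ⊔ gradedTail ℳ n₀ = ⊤ := by
  rw [eq_top_iff, ← iSup_eq_top_of_decomposition ℳ]
  refine iSup_le fun n => ?_
  by_cases h1 : n < -(b : ℤ)
  · rw [h.eq_bot n h1]; exact bot_le
  by_cases h2 : (n₀ : ℤ) ≤ n
  · exact (le_gradedTail h2).trans le_sup_right
  · refine le_trans ?_ le_sup_left
    refine le_iSup₂_of_le (n + b).toNat (Finset.mem_range.2 (by omega)) ?_
    rw [show ((n + b).toNat : ℤ) - b = n by omega]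

theorem gradedInitial_fg (m : ℕ) : (gradedInitial ℳ b m).FG :=
  Submodule.fg_biSup _ _ fun _ _ => (Submodule.fg_iff_finiteDimensional _).2 (h.finite _)

/-- The tail is an A-submodule with finite dimensional quotient. Its A-submodules are in particular
stable under the commuting even operators, so each is generated by a finite dimensional subspace. -/
theorem isNoetherian (hfin : GradedLocallyFinite 𝒜) : IsNoetherian Aᵐᵒᵖ M := by
  let T : Submodule Aᵐᵒᵖ M :=
    { gradedTail ℳ n₀ with
      smul_mem' := fun a x hx => by
        change op (unop a) • x ∈ gradedTail ℳ n₀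
        generalize unop a = a
        have : (⊤ : Submodule k A) ≤ (gradedTail ℳ n₀).comap ((rightMul k A M).flip x) := by
          rw [← iSup_eq_top_of_decomposition 𝒜]
          exact iSup_le fun j c hc => h.op_smul_mem_gradedTail hc hx
        exact this (Submodule.mem_top (x := a)) }
  have hT : IsNoetherian Aᵐᵒᵖ T := by
    refine isNoetherian_submodule.2 fun N hN => ?_
    have stable (P : Submodule Aᵐᵒᵖ M) : IsStable (evenMul M hfin d) (P.restrictScalars k) :=
      (isStable_evenMul_iff hfin).2 fun j _ c _ x hx => P.smul_mem (op c) hx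
    obtain ⟨F, hFN, ⟨S, rfl⟩, hgen⟩ :=
      h.exists_fg_generating_evenMul hfin (N.restrictScalars k) hN (stable N)
    refine ⟨S, le_antisymm (Submodule.span_le.2 fun x hx => hFN (Submodule.subset_span hx)) ?_⟩
    exact hgen ((Submodule.span Aᵐᵒᵖ (S : Set M)).restrictScalars k)
      (Submodule.span_le.2 Submodule.subset_span) (stable _)
  have hQ : IsNoetherian Aᵐᵒᵖ (M ⧸ T) := by
    have := (Submodule.fg_iff_finiteDimensional _).1 (h.gradedInitial_fg (b + n₀))
    have : Module.Finite k (M ⧸ T) := by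
      refine Module.Finite.of_surjective
        ((T.mkQ.restrictScalars k) ∘ₗ (gradedInitial ℳ b (b + n₀)).subtype) fun y => ?_
      obtain ⟨x, rfl⟩ := T.mkQ_surjective y
      obtain ⟨u, hu, v, hv, rfl⟩ := Submodule.mem_sup.1
        (h.gradedInitial_sup_gradedTail ▸ Submodule.mem_top (x := x))
      refine ⟨⟨u, hu⟩, ?_⟩
      have : v ∈ T := hv
      simpa using this
    have : IsNoetherian k (M ⧸ T) := inferInstance
    exact isNoetherian_of_tower k this
  exact isNoetherian_of_range_eq_ker T.subtype T.mkQ (by simp)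

theorem exists_prod_mul_series (hfin : GradedLocallyFinite 𝒜) :
    ∃ p : Polynomial ℚ, (∏ i : EvenIndex 𝒜 d, (1 - PowerSeries.X ^ (2 * (i.1.1 + 1)))) *
      PowerSeries.mk (fun n : ℕ => (Module.finrank k (ℳ (n - b)) : ℚ)) = p := by
  have htail : ∀ n : ℤ, n₀ ≤ n → gradedTail ℳ n₀ ⊓ ℳ n = ℳ n := fun n hn =>
    inf_eq_right.2 (le_gradedTail hn)
  have hbot : ∀ n : ℤ, n < n₀ → gradedTail ℳ n₀ ⊓ ℳ n = ⊥ := by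
    refine fun n hn => eq_bot_iff.2 fun x hx => ?_
    rw [Submodule.mem_bot, ← gradedProj_of_mem ℳ hx.2]
    exact gradedProj_eq_zero_of_mem_biSup ℳ hx.1 (by simpa using hn)
  obtain ⟨p, hp⟩ := exists_prod_mul_quotientSeries ℳ (evenMul M hfin d)
    (fun i => 2 * (i.1.1 + 1)) h.finite
    (fun i n x hx => h.smul_mem _ n _ (Subtype.property _) x hx) (T := gradedTail ℳ n₀)
    (n₀ := -(b : ℤ)) (fun n hn => hbot n (by omega))
    (fun i j x hx => h.comm_gradedTail (even_two_mul _) (Subtype.property _) hx _)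
    (h.exists_fg_generating_evenMul hfin) Finset.univ (gradedTail ℳ n₀) ⊥ le_rfl bot_le
    ((isStable_evenMul_iff hfin).2 fun j _ c hc x hx => h.op_smul_mem_gradedTail hc hx)
    (fun i x hx => by rw [(Submodule.mem_bot k).1 hx, map_zero]; exact zero_mem _)
    (fun n x hx => by
      by_cases hn : (n₀ : ℤ) ≤ n
      · exact le_gradedTail hn (gradedProj_mem ℳ n x)
      · rw [gradedProj_eq_zero_of_mem_biSup ℳ hx hn]
        exact zero_mem _)
    (fun n x hx => by rw [(Submodule.mem_bot k).1 hx, map_zero]; exact zero_mem _)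
    (fun i hi => absurd (Finset.mem_univ i) hi)
  set Q := quotientSeries ℳ (-(b : ℤ)) (gradedTail ℳ n₀) ⊥
  set F := PowerSeries.mk (fun n : ℕ => (Module.finrank k (ℳ (n - b)) : ℚ))
  -- Coefficient n belongs to degree n - b, so the series of M and of its tail agree from n = b + n₀
  -- on.
  obtain ⟨t, hF⟩ : ∃ t : Polynomial ℚ, F = Q + t := by
    refine ⟨(F - Q).trunc (b + n₀), ?_⟩
    ext n
    rw [map_add, Polynomial.coeff_coe, PowerSeries.coeff_trunc]
    split_ifs with hn
    · rw [map_sub]; ring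
    · simp only [F, Q, quotientSeries, PowerSeries.coeff_mk]
      rw [bot_inf_eq, finrank_bot, htail _ (by omega), Nat.cast_zero, sub_zero, add_zero,
        neg_add_eq_sub]
  refine ⟨p + (∏ i : EvenIndex 𝒜 d, (1 - Polynomial.X ^ (2 * (i.1.1 + 1)))) * t, ?_⟩
  rw [hF, mul_add, hp]
  simp only [← Polynomial.coeToPowerSeries.ringHom_apply, map_add, map_mul, map_prod, map_sub,
    map_one, map_pow]
  simp only [Polynomial.coeToPowerSeries.ringHom_apply, Polynomial.coe_X]

theorem finrank_gradedInitial (m : ℕ) : Module.finrank k ↥(gradedInitial ℳ b m) =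
    ∑ i ∈ Finset.range (m + 1), Module.finrank k (ℳ (i - b)) :=
  finrank_biSup_of_iSupIndep (N := fun i : ℕ => ℳ (i - b))
    ((DirectSum.Decomposition.isInternal ℳ).submodule_iSupIndep.comp fun i j hij => by
      simpa using hij) (fun i => h.finite _) _

theorem le_gradedInitial {m : ℕ} {n : ℤ} (hn : n ≤ m - b) : ℳ n ≤ gradedInitial ℳ b m := by
  by_cases h1 : n < -(b : ℤ)
  · rw [h.eq_bot n h1]; exact bot_le
  · refine le_iSup₂_of_le (n + b).toNat (Finset.mem_range.2 (by omega)) ?_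
    rw [show ((n + b).toNat : ℤ) - b = n by omega]

theorem exists_le_gradedInitial {F : Submodule k M} (hF : F.FG) :
    ∃ a, F ≤ gradedInitial ℳ b a := by
  obtain ⟨s, hs⟩ := exists_finset_of_fg ℳ hF
  obtain ⟨u, hu⟩ := s.bddAbove
  refine ⟨(u + b).toNat, fun x hx => mem_of_gradedProj_mem ℳ fun n => ?_⟩
  by_cases hn : n ∈ s
  · have := hu hn
    exact h.le_gradedInitial (by omega) (gradedProj_mem ℳ n x)
  · rw [hs x hx n hn]; exact zero_mem _

theorem exists_rightMulSpan_pow_le {F : Submodule k M} (hF : F.FG) {V : Submodule k A}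
    (hV : V.FG) : ∃ a c : ℕ, ∀ n, rightMulSpan F (V ^ n) ≤ gradedInitial ℳ b (a + c * n) := by
  obtain ⟨a, ha⟩ := h.exists_le_gradedInitial hF
  obtain ⟨s, hs⟩ := exists_finset_of_fg 𝒜 hV
  obtain ⟨c, hc⟩ := s.bddAbove
  refine ⟨a, c, fun n => ?_⟩
  induction n with
  | zero =>
    rw [pow_zero]
    refine rightMulSpan_le.2 fun m hm v hv => ?_
    obtain ⟨r, rfl⟩ := Submodule.mem_one.1 hv
    rw [← rightMul_apply (k := k), Algebra.algebraMap_eq_smul_one, map_smul, LinearMap.smul_apply,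
      rightMul_apply, op_one, one_smul]
    exact Submodule.smul_mem _ _ (ha hm)
  | succ n ih =>
    rw [pow_succ]
    refine (rightMulSpan_mul_le _ _ _).trans ((rightMulSpan_mono ih le_rfl).trans ?_)
    refine rightMulSpan_le.2 fun m hm v hv => ?_
    have hv' : v ∈ ⨆ j ∈ (s : Set ℕ), 𝒜 j := mem_biSup_of_gradedProj 𝒜 fun j hj => hs v hv j hj
    have hle : ⨆ j ∈ (s : Set ℕ), 𝒜 j ≤
        (gradedInitial ℳ b (a + c * (n + 1))).comap ((rightMul k A M).flip m) := by
      refine iSup₂_le fun j hj w hw => ?_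
      have : gradedInitial ℳ b (a + c * n) ≤
          (gradedInitial ℳ b (a + c * (n + 1))).comap (rightMul k A M w) := by
        refine iSup₂_le fun i hi y hy => h.le_gradedInitial ?_ (h.smul_mem j _ w hw y hy)
        rw [Finset.mem_range] at hi
        have hjc : j ≤ c := hc hj
        have : i + j ≤ a + c * (n + 1) := by rw [mul_add]; omega
        omega
      exact this hm
    exact hle hv'

/-- Each further factor V reaches at least one more degree, since large components are generated
from lower ones by degrees 1 to d. This is the lower bound for growth. -/
theorem le_rightMulSpan_pow {F : Submodule k M} {V : Submodule k A} (hV : ∀ j ≤ d, 𝒜 j ≤ V)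
    {n₁ : ℤ} (hn₁ : n₀ ≤ n₁) (hF : ∀ n ≤ n₁, ℳ n ≤ F) (m : ℕ) :
    ∀ n ≤ n₁ + m, ℳ n ≤ rightMulSpan F (V ^ m) := by
  have h1 : (1 : A) ∈ V := hV 0 (Nat.zero_le _) SetLike.GradedOne.one_mem
  induction m with
  | zero =>
    intro n hn x hx
    have := op_smul_mem_rightMulSpan (hF n (by simpa using hn) hx)
      (pow_zero V ▸ Submodule.one_le.1 le_rfl)
    rwa [op_one, one_smul] at this
  | succ m ih =>
    intro n hn
    push_cast at hn
    rw [pow_succ]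
    refine le_trans ?_ (rightMulSpan_rightMulSpan_le _ _ _)
    by_cases hn' : n ≤ n₁ + m
    · intro x hx
      have := op_smul_mem_rightMulSpan (ih n hn' hx) h1
      rwa [op_one, one_smul] at this
    · refine (h.generated n (by omega)).trans (iSup₂_le fun j hj => ?_)
      rw [Finset.mem_Icc] at hj
      exact rightMulSpan_mono (ih _ (by omega)) (hV j hj.2)

theorem hasRationalHilbertSeries (hfin : GradedLocallyFinite 𝒜) : HasRationalHilbertSeries ℳ := by
  refine ⟨h.finite, ?_⟩
  obtain ⟨p, hp⟩ := h.exists_prod_mul_series hfin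
  set F := PowerSeries.mk (fun n : ℕ => (Module.finrank k (ℳ (n - b)) : ℚ)) with hF
  -- The series F is shifted by b, so X^(-b) restores the degrees and X^b joins the denominator.
  refine ⟨HahnSeries.single (-(b : ℤ)) 1 * (F : LaurentSeries ℚ), fun n => ?_,
    p, Polynomial.X ^ b * ∏ i : EvenIndex 𝒜 d, (1 - Polynomial.X ^ (2 * (i.1.1 + 1))), ?_, ?_⟩
  · rw [show n = (n + b) + -(b : ℤ) by ring, HahnSeries.coeff_single_mul_add, one_mul]
    rcases lt_or_ge (n + b) 0 with hn | hn
    · rw [PowerSeries.coeff_coe, if_pos hn, h.eq_bot _ (by omega), finrank_bot, Nat.cast_zero]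
    · obtain ⟨m, hm⟩ := Int.eq_ofNat_of_zero_le hn
      rw [hm, LaurentSeries.coeff_coe_powerSeries, hF, PowerSeries.coeff_mk, sub_eq_add_neg]
  · refine mul_ne_zero (pow_ne_zero _ Polynomial.X_ne_zero) (Finset.prod_ne_zero_iff.2 ?_)
    intro i _ h0
    have := congrArg (Polynomial.eval 0) h0
    simp at this
  · have hX : ((Polynomial.X ^ b * ∏ i : EvenIndex 𝒜 d,
        (1 - Polynomial.X ^ (2 * (i.1.1 + 1))) : Polynomial ℚ) : PowerSeries ℚ) =
        (∏ i : EvenIndex 𝒜 d, (1 - PowerSeries.X ^ (2 * (i.1.1 + 1)))) * PowerSeries.X ^ b := by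
      simp only [← Polynomial.coeToPowerSeries.ringHom_apply, map_mul, map_prod, map_sub,
        map_one, map_pow]
      simp only [Polynomial.coeToPowerSeries.ringHom_apply, Polynomial.coe_X]
      rw [mul_comm]
    have hXb : ((PowerSeries.X ^ b : PowerSeries ℚ) : LaurentSeries ℚ) *
        HahnSeries.single (-(b : ℤ)) 1 = 1 := by
      rw [HahnSeries.ofPowerSeries_X_pow, HahnSeries.single_mul_single]
      simp
    rw [hX, map_mul, mul_assoc, ← mul_assoc _ (HahnSeries.single _ _), hXb, one_mul, ← map_mul, hp]

/-- FV^n lies in degrees at most linear in n, and contains all degrees up to n - b when F and V are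
large. Both bounds have the same integral exponent. The second conclusion records the lower bound
for reuse with powers V^n in A itself. -/
theorem exists_gkDimRight_eq (hfin : GradedLocallyFinite 𝒜) :
    ∃ r : ℕ, gkDimRight k A M = ((r : ℝ) : EReal) ∧
      ∀ f : ℕ → ℕ, (∀ᶠ n in Filter.atTop, Module.finrank k ↥(gradedInitial ℳ b n) ≤ f n) →
        ((r : ℝ) : EReal) ≤ growthExponent f := by
  obtain ⟨p, hp⟩ := h.exists_prod_mul_series hfin
  obtain ⟨r, hle, hge⟩ := exists_growth_degree (fun i : EvenIndex 𝒜 d => 2 * (i.1.1 + 1))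
    (fun i => by omega) Finset.univ _ hp
  simp only [← h.finrank_gradedInitial] at hle hge
  refine ⟨r, le_antisymm ?_ ?_, hge⟩
  · refine iSup_le fun F => iSup_le fun hF => iSup_le fun V => iSup_le fun hV => iSup_le fun _ => ?_
    obtain ⟨a, c, hac⟩ := h.exists_rightMulSpan_pow_le hF hV
    refine hle _ a c fun n => ?_
    have := (Submodule.fg_iff_finiteDimensional _).1 (h.gradedInitial_fg (a + c * n))
    exact Submodule.finrank_mono (hac n)
  · let V : Submodule k A := ⨆ j ∈ Finset.range (d + 1), 𝒜 j
    have hVj : ∀ j ≤ d, 𝒜 j ≤ V := fun j hj =>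
      le_iSup₂_of_le j (Finset.mem_range.2 (by omega)) le_rfl
    have hV : V.FG := Submodule.fg_biSup _ _ fun j _ =>
      (Submodule.fg_iff_finiteDimensional _).2 (hfin j)
    refine le_trans ?_ (le_iSup_of_le (gradedInitial ℳ b (b + n₀)) <|
      le_iSup_of_le (h.gradedInitial_fg _) <| le_iSup_of_le V <| le_iSup_of_le hV <|
      le_iSup_of_le (hVj 0 (Nat.zero_le _) SetLike.GradedOne.one_mem) le_rfl)
    refine hge _ (Filter.Eventually.of_forall fun n => ?_)
    -- The upper inclusion serves only to make FV^n finite dimensional, so that `finrank` is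
    -- monotone.
    obtain ⟨a, c, hac⟩ := h.exists_rightMulSpan_pow_le (h.gradedInitial_fg (b + n₀)) hV
    have := (Submodule.fg_iff_finiteDimensional _).1 (h.gradedInitial_fg (a + c * n))
    have := Submodule.finiteDimensional_of_le (hac n)
    refine Submodule.finrank_mono (iSup₂_le fun i hi => ?_)
    rw [Finset.mem_range] at hi
    exact h.le_rightMulSpan_pow hVj le_rfl (fun m hm => h.le_gradedInitial (by omega)) n _
      (by omega)

end HasCentralTail

end CentralTail

/-! ### The algebra as a right module over itself, and its even Veronese subring -/

section SelfGrading

variable {k A : Type*} [Field k] [Ring A] [Algebra k A] (𝒜 : ℕ → Submodule k A) [GradedAlgebra 𝒜]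

/-- The `ℕ`-grading of `A`, extended by zero to a `ℤ`-grading. -/
def intGrading (n : ℤ) : Submodule k A := if 0 ≤ n then 𝒜 n.toNat else ⊥

theorem intGrading_natCast (n : ℕ) : intGrading 𝒜 n = 𝒜 n := by
  simp [intGrading]

theorem intGrading_of_neg {n : ℤ} (hn : n < 0) : intGrading 𝒜 n = ⊥ :=
  if_neg (by omega)

theorem intGrading_le (n : ℤ) : intGrading 𝒜 n ≤ 𝒜 n.toNat := by
  unfold intGrading
  split_ifs
  · exact le_rfl
  · exact bot_le

theorem isGradedRightModule_intGrading : IsGradedRightModule 𝒜 (intGrading 𝒜) where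
  isInternal := by
    rw [DirectSum.isInternal_submodule_iff_iSupIndep_and_iSup_eq_top]
    constructor
    · intro i
      rcases lt_or_ge i 0 with hi | hi
      · rw [intGrading_of_neg 𝒜 hi]
        exact disjoint_bot_left
      · obtain ⟨m, rfl⟩ := Int.eq_ofNat_of_zero_le hi
        rw [intGrading_natCast]
        refine ((DirectSum.Decomposition.isInternal 𝒜).submodule_iSupIndep m).mono_right
          (iSup₂_le fun j hj => ?_)
        rcases lt_or_ge j 0 with hj0 | hj0
        · rw [intGrading_of_neg 𝒜 hj0]
          exact bot_le
        · exact (intGrading_le 𝒜 j).trans (le_iSup₂_of_le j.toNat (by omega) le_rfl)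
    · rw [eq_top_iff, ← iSup_eq_top_of_decomposition 𝒜]
      exact iSup_le fun n => le_iSup_of_le (n : ℤ) (intGrading_natCast 𝒜 n).ge
  smul_mem i j a ha m hm := by
    rcases lt_or_ge j 0 with hj | hj
    · rw [intGrading_of_neg 𝒜 hj, Submodule.mem_bot] at hm
      rw [hm, smul_zero]
      exact zero_mem _
    · obtain ⟨j, rfl⟩ := Int.eq_ofNat_of_zero_le hj
      rw [intGrading_natCast] at hm
      rw [← Nat.cast_add, intGrading_natCast]
      exact SetLike.mul_mem_graded hm ha

noncomputable instance : DirectSum.Decomposition (intGrading 𝒜) :=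
  (isGradedRightModule_intGrading 𝒜).isInternal.chooseDecomposition

theorem rightMulSpan_one (W : Submodule k A) : rightMulSpan (1 : Submodule k A) W = W := by
  refine le_antisymm (rightMulSpan_le.2 fun m hm a ha => ?_) fun a ha => ?_
  · obtain ⟨r, rfl⟩ := Submodule.mem_one.1 hm
    rw [op_smul_eq_mul, ← Algebra.smul_def]
    exact W.smul_mem r ha
  · have := op_smul_mem_rightMulSpan (Submodule.one_le.1 (le_refl (1 : Submodule k A))) ha
    rwa [op_smul_eq_mul, one_mul] at this

variable {𝒜} {b d n₀ : ℕ}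

/-- The upper bound is V^n = 1·V^n, a case of the module dimension. For the lower bound V takes both
roles: V^n = V·V^(n-1) with V containing all degrees up to `d + n₀ + 1`, so that V^n contains all
degrees up to n. -/
theorem exists_gkDim_eq (h : HasCentralTail 𝒜 (intGrading 𝒜) b d n₀)
    (hfin : GradedLocallyFinite 𝒜) : ∃ r : ℕ, gkDim k A = ((r : ℝ) : EReal) := by
  obtain ⟨r, hr, hge⟩ := h.exists_gkDimRight_eq hfin
  refine ⟨r, le_antisymm ?_ ?_⟩
  · rw [← hr]
    refine iSup_le fun V => iSup_le fun hV => iSup_le fun h1 => ?_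
    refine le_iSup_of_le 1 <| le_iSup_of_le ⟨{1}, by simp [Submodule.one_eq_span]⟩ <|
      le_iSup_of_le V <| le_iSup_of_le hV <| le_iSup_of_le h1 ?_
    have hpow : (fun n => Module.finrank k ↥(rightMulSpan (1 : Submodule k A) (V ^ n))) =
        fun n => Module.finrank k ↥(V ^ n) := funext fun n => by rw [rightMulSpan_one]
    exact (congrArg growthExponent hpow).ge
  · let V : Submodule k A := ⨆ j ∈ Finset.range (d + n₀ + 2), 𝒜 j
    have hVj : ∀ j ≤ d + n₀ + 1, 𝒜 j ≤ V := fun j hj =>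
      le_iSup₂_of_le j (Finset.mem_range.2 (by omega)) le_rfl
    have hV : V.FG := Submodule.fg_biSup _ _ fun j _ =>
      (Submodule.fg_iff_finiteDimensional _).2 (hfin j)
    refine le_trans ?_ (le_iSup_of_le V <| le_iSup_of_le hV <|
      le_iSup_of_le (hVj 0 (Nat.zero_le _) SetLike.GradedOne.one_mem) le_rfl)
    refine hge _ ?_
    filter_upwards [Filter.eventually_ge_atTop 1] with n hn
    obtain ⟨m, rfl⟩ := Nat.exists_eq_add_of_le' hn
    have := (Submodule.fg_iff_finiteDimensional _).1 (hV.pow (m + 1))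
    refine Submodule.finrank_mono (iSup₂_le fun i hi => ?_)
    rw [Finset.mem_range] at hi
    refine (h.le_rightMulSpan_pow (F := V) (V := V) (fun j hj => hVj j (by omega))
      (n₁ := n₀ + 1) (by omega) (fun n hn => (intGrading_le 𝒜 n).trans (hVj _ (by omega))) m _
      (by omega)).trans (rightMulSpan_le.2 fun x hx a ha => ?_)
    rw [op_smul_eq_mul, pow_succ']
    exact Submodule.mul_mem_mul hx ha

theorem isRationalSeries_hilbertSeries (h : HasRationalHilbertSeries (intGrading 𝒜)) :
    IsRationalSeries (hilbertSeries 𝒜 : LaurentSeries ℚ) := by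
  obtain ⟨-, H, hH, hrat⟩ := h
  convert hrat using 1
  ext n
  rw [hH]
  rcases lt_or_ge n 0 with hn | hn
  · rw [PowerSeries.coeff_coe, if_pos hn, intGrading_of_neg 𝒜 hn, finrank_bot, Nat.cast_zero]
  · obtain ⟨n, rfl⟩ := Int.eq_ofNat_of_zero_le hn
    rw [LaurentSeries.coeff_coe_powerSeries, hilbertSeries, PowerSeries.coeff_mk,
      intGrading_natCast]

theorem le_veronese (w i : ℕ) : 𝒜 (w * i) ≤ (veronese 𝒜 w).toSubmodule :=
  le_iSup (fun i => 𝒜 (w * i)) i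

theorem finiteType_veronese (h : HasCentralTail 𝒜 (intGrading 𝒜) b d n₀)
    (hfin : GradedLocallyFinite 𝒜) : Algebra.FiniteType k (veronese 𝒜 2) := by
  rw [← Subalgebra.fg_iff_finiteType]
  let V : Submodule k A := ⨆ i ∈ Finset.range (n₀ + 2 * d + 1), 𝒜 (2 * i)
  obtain ⟨S, hS⟩ : V.FG := Submodule.fg_biSup _ _ fun j _ =>
    (Submodule.fg_iff_finiteDimensional _).2 (hfin _)
  refine ⟨S, le_antisymm (Algebra.adjoin_le fun x hx => ?_) ?_⟩
  · have hV : V ≤ (veronese 𝒜 2).toSubmodule := iSup₂_le fun i _ => le_veronese 2 i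
    exact hV (hS ▸ Submodule.subset_span hx)
  set B := Algebra.adjoin k (S : Set A)
  have hVB : ∀ i ≤ n₀ + 2 * d, 𝒜 (2 * i) ≤ B.toSubmodule := fun i hi =>
    (le_iSup₂_of_le (f := fun i (_ : i ∈ Finset.range (n₀ + 2 * d + 1)) => 𝒜 (2 * i)) i
      (Finset.mem_range.2 (by omega)) le_rfl).trans
      (hS.symm.le.trans (Submodule.span_le.2 Algebra.subset_adjoin))
  -- Only even components are constrained: `gradedTail_le` needs a subspace that also contains the
  -- low odd components. Right multiplication by an even element preserves parity, so L is stable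
  -- under the even generators, which lie in B.
  let L : Submodule k A := ⨅ n, B.toSubmodule.comap (gradedProj 𝒜 (2 * n))
  have hL : ∀ x, x ∈ L ↔ ∀ n, gradedProj 𝒜 (2 * n) x ∈ B := fun x => by
    simp only [L, Submodule.mem_iInf, Submodule.mem_comap, Subalgebra.mem_toSubmodule]
  have hU : ∀ m ≤ n₀ + 2 * d, 𝒜 m ≤ L := by
    intro m hm x hx
    rw [hL]
    intro n
    by_cases hmn : m = 2 * n
    · subst hmn
      rw [gradedProj_of_mem 𝒜 hx]
      exact hVB n (by omega) hx
    · rw [gradedProj_of_mem_ne 𝒜 hx hmn]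
      exact zero_mem _
  have hT : gradedTail (intGrading 𝒜) n₀ ≤ L := by
    refine h.gradedTail_le (fun n h1 h2 => (intGrading_le 𝒜 n).trans (hU _ (by omega))) ?_
    intro j hj c hc x hx
    rw [hL] at hx ⊢
    intro n
    rw [op_smul_eq_mul, gradedProj_apply]
    by_cases hle : 2 * (j + 1) ≤ 2 * n
    · rw [DirectSum.coe_decompose_mul_of_right_mem_of_le 𝒜 hc hle, ← Nat.mul_sub]
      exact B.mul_mem (hx _) (hVB _ (by omega) hc)
    · rw [DirectSum.coe_decompose_mul_of_right_mem_of_not_le 𝒜 hc hle]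
      exact zero_mem _
  have hLn : ∀ n, 𝒜 (2 * n) ≤ B.toSubmodule := by
    intro n x hx
    have hxL : x ∈ L := by
      by_cases hn : 2 * n ≤ n₀ + 2 * d
      · exact hU _ hn hx
      · refine hT (le_gradedTail (n := ((2 * n : ℕ) : ℤ)) (by omega) ?_)
        rwa [intGrading_natCast]
    have := (hL x).1 hxL n
    rwa [gradedProj_of_mem 𝒜 hx] at this
  intro x hx
  exact (iSup_le hLn : ⨆ i, 𝒜 (2 * i) ≤ B.toSubmodule) hx

/-- The components of A up to degree `n₀ + 2 * d` generate: their span over the Veronese subring is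
stable under even elements, so it contains the tail by `gradedTail_le`. -/
theorem moduleFinite_veronese (h : HasCentralTail 𝒜 (intGrading 𝒜) b d n₀) :
    Module.Finite (veronese 𝒜 2).op A := by
  obtain ⟨S, hS⟩ := h.gradedInitial_fg (b + n₀ + 2 * d)
  let L : Submodule k A := (Submodule.span (veronese 𝒜 2).op (S : Set A)).restrictScalars k
  have hSL : gradedInitial (intGrading 𝒜) b (b + n₀ + 2 * d) ≤ L := by
    rw [← hS]
    exact Submodule.span_le.2 Submodule.subset_span
  have hT : gradedTail (intGrading 𝒜) n₀ ≤ L := by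
    refine h.gradedTail_le (fun n _ h2 => (h.le_gradedInitial (by push_cast; omega)).trans hSL) ?_
    intro j _ c hc x hx
    exact (Submodule.span (veronese 𝒜 2).op (S : Set A)).smul_mem
      ⟨op c, le_veronese 2 (j + 1) hc⟩ hx
  refine ⟨⟨S, eq_top_iff.2 fun x _ => ?_⟩⟩
  have hx : x ∈ gradedInitial (intGrading 𝒜) b (b + n₀) ⊔ gradedTail (intGrading 𝒜) n₀ :=
    h.gradedInitial_sup_gradedTail ▸ Submodule.mem_top
  refine (sup_le ?_ hT : _ ≤ L) hx
  exact (iSup₂_le fun i hi => h.le_gradedInitial (by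
    rw [Finset.mem_range] at hi
    push_cast
    omega)).trans hSL

variable {T : TypeDecomposition 𝒜}

/-- The sign -1 requires both degrees to be odd, so it never occurs for c of even degree. The
identity is then linear in a and c and extends from typed homogeneous elements. -/
theorem IsPGPerm.mul_mul_comm_of_even (hA : IsPGPerm 𝒜 T) (i : ℕ) (hi : 2 ≤ i) (x : A)
    (hx : x ∈ 𝒜 i) (j : ℕ) (hj : Even j) (c : A) (hc : c ∈ 𝒜 j) (a : A) :
    x * (c * a) = x * (a * c) := by
  have typed : ∀ s, ∀ c ∈ T.comp s j, ∀ a : A, x * (c * a) = x * (a * c) := by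
    intro s c hc a
    have hK : ⊤ ≤ LinearMap.ker (LinearMap.mulLeft k x ∘ₗ
        (LinearMap.mulLeft k c - LinearMap.mulRight k c)) := by
      rw [← iSup_eq_top_of_decomposition 𝒜]
      refine iSup_le fun l => ?_
      rw [← T.sup_eq l]
      have typed' : ∀ t, T.comp t l ≤ LinearMap.ker (LinearMap.mulLeft k x ∘ₗ
          (LinearMap.mulLeft k c - LinearMap.mulRight k c)) := fun t y hy => by
        have := hA.perm i hi x hx s t j l c hc y hy
        rw [if_neg fun h => Nat.not_odd_iff_even.2 hj h.2.2.1, one_smul] at this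
        simp [mul_sub, this]
      exact sup_le (typed' _) (typed' _)
    have := hK (Submodule.mem_top (x := a))
    simpa [mul_sub, sub_eq_zero] using this
  rw [← T.sup_eq j] at hc
  obtain ⟨u, hu, v, hv, rfl⟩ := Submodule.mem_sup.1 hc
  rw [add_mul, mul_add, mul_add, mul_add, typed _ u hu, typed _ v hv]

/-- Degree at least 1 in the Veronese grading means degree at least 2 in A, which is where even
elements can be swapped. -/
theorem IsPGPerm.isGPerm_veronese (hA : IsPGPerm 𝒜 T) : IsGPerm (veroneseGrading 𝒜 2) where
  locallyFinite i := by
    have := hA.locallyFinite (2 * i)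
    refine Module.Finite.of_injective
      ((veronese 𝒜 2).val.toLinearMap.restrict (p := veroneseGrading 𝒜 2 i) (q := 𝒜 (2 * i))
        fun x hx => hx) fun x y hxy => ?_
    exact Subtype.ext (Subtype.ext (Subtype.ext_iff.1 hxy :))
  perm := by
    intro a ha b c
    have hle : ⨆ i, ⨆ (_ : 1 ≤ i), veroneseGrading 𝒜 2 i ≤
        LinearMap.ker (LinearMap.mulRight k (b * c - c * b)) := by
      refine iSup₂_le fun i hi a ha => ?_
      rw [LinearMap.mem_ker, LinearMap.mulRight_apply, mul_sub, sub_eq_zero]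
      apply Subtype.ext
      have hb : ⨆ j, 𝒜 (2 * j) ≤ LinearMap.ker (LinearMap.mulLeft k (a : A) ∘ₗ
          (LinearMap.mulRight k (c : A) - LinearMap.mulLeft k (c : A))) :=
        iSup_le fun j y hy => by
          have := hA.mul_mul_comm_of_even (2 * i) (by omega) a ha (2 * j) (even_two_mul j) y hy c
          simp [mul_sub, this]
      have := hb b.2
      simpa [mul_sub, sub_eq_zero] using this
    have := hle ha
    rwa [LinearMap.mem_ker, LinearMap.mulRight_apply, mul_sub, sub_eq_zero] at this

end SelfGrading

/-! ### Assembly of the theorem -/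

theorem finite_op_self (A : Type*) [Ring A] : Module.Finite Aᵐᵒᵖ A :=
  ⟨⟨{1}, eq_top_iff.2 fun a _ => by
    rw [Finset.coe_singleton]
    exact Submodule.mem_span_singleton.2 ⟨op a, one_mul a⟩⟩⟩

theorem IsPGPerm.exists_hasCentralTail {k A : Type*} [Field k] [Ring A] [Algebra k A]
    {𝒜 : ℕ → Submodule k A} [GradedAlgebra 𝒜] {T : TypeDecomposition 𝒜} (hA : IsPGPerm 𝒜 T)
    {d : ℕ} (hd : IsGeneratedInDegreeLE 𝒜 d) :
    ∃ b n₀ : ℕ, HasCentralTail 𝒜 (intGrading 𝒜) b d n₀ :=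
  have := finite_op_self A
  _root_.exists_hasCentralTail (intGrading 𝒜) hA.locallyFinite hA.mul_mul_comm_of_even hd
    (isGradedRightModule_intGrading 𝒜).smul_mem

theorem lemma3p8 {k : Type*} [Field k] {A : Type*} [Ring A] [Algebra k A]
    (𝒜 : ℕ → Submodule k A) [GradedAlgebra 𝒜] (T : TypeDecomposition 𝒜)
    (hA : IsPGPerm 𝒜 T) (hfg : Algebra.FiniteType k A) :
    (Algebra.FiniteType k (veronese 𝒜 2) ∧ IsGPerm (veroneseGrading 𝒜 2)) ∧
    (Module.Finite (veronese 𝒜 2).op A ∧ IsNoetherian Aᵐᵒᵖ A) ∧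
    IsRationalSeries (hilbertSeries 𝒜 : LaurentSeries ℚ) ∧
    (∃ d : ℕ, gkDim k A = ((d : ℝ) : EReal)) ∧
    (∀ (M : Type*) [AddCommGroup M] [Module k M] [Module Aᵐᵒᵖ M] [IsScalarTower k Aᵐᵒᵖ M]
      (ℳ : ℤ → Submodule k M), IsGradedRightModule 𝒜 ℳ → Module.Finite Aᵐᵒᵖ M →
        IsNoetherian Aᵐᵒᵖ M ∧ (∃ d : ℕ, gkDimRight k A M = ((d : ℝ) : EReal)) ∧
          HasRationalHilbertSeries ℳ) := by
  have hfin := hA.locallyFinite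
  obtain ⟨d, hd⟩ := exists_isGeneratedInDegreeLE 𝒜 hfg
  obtain ⟨b, n₀, h⟩ := hA.exists_hasCentralTail hd
  refine ⟨⟨finiteType_veronese h hfin, hA.isGPerm_veronese⟩,
    ⟨moduleFinite_veronese h, h.isNoetherian hfin⟩,
    isRationalSeries_hilbertSeries (h.hasRationalHilbertSeries hfin), exists_gkDim_eq h hfin, ?_⟩
  intro M _ _ _ _ ℳ hℳ _
  let _ : DirectSum.Decomposition ℳ := hℳ.isInternal.chooseDecomposition
  obtain ⟨b, n₀, h⟩ := exists_hasCentralTail ℳ hfin hA.mul_mul_comm_of_even hd hℳ.smul_mem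
  obtain ⟨r, hr, -⟩ := h.exists_gkDimRight_eq hfin
  exact ⟨h.isNoetherian hfin, ⟨r, hr⟩, h.hasRationalHilbertSeries hfin⟩
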